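/- **Conventions.** An $\mathbb N$-vector is a function $\mathbf m:\{1,2,\dots\}\to\mathbb Z_{\ge 0}$ of finite support; $FIN(\mathbb N)$ is the set of all of them, with pointwise addition and order. A *label* is a set $\mathcal M\subset FIN(\mathbb N)$ such that $\mathbf m_1\le\mathbf m\in\mathcal M$ implies $\mathbf m_1\in\mathcal M$. The space of labels carries the ultrametric $d(\mathcal M_1,\mathcal M_2)=\inf\{2^{-N}: N\ge 0,\ \mathcal M_1\cap\mathcal B_N=\mathcal M_2\cap\mathcal B_N\}$, where $\mathcal B_0=\emptyset$ and, for $N\geq 1$, $\mathcal B_N$ is the set of $\mathbb N$-vectors supported in $\{1,\dots,N\}$ with entries at most $N$. Put $\mathcal M-\mathbf r=\{\mathbf w\in FIN(\mathbb N):\mathbf w+\mathbf r\in\mathcal M\}$, and let $\Theta(\mathcal M)$ be the closure of $\{\mathcal M-\mathbf r:\mathbf r\in FIN(\mathbb N)\}$ in the space of labels. A label $\mathcal M$ is * *bounded* if there is $\mu:\{1,2,\dots\}\to\mathbb Z_{\ge0}$ with $\mathbf m\le\mu$ for all $\mathbf m\in\mathcal M$; * *of finite type* if it contains no infinite strictly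 increasing sequence; * *finitary* if it is bounded and, whenever $(S_i)$ is a sequence of finite sets of positive integers with $\bigcup_i S_i$ infinite, there are only finitely many sets $S$ such that for all large $i$ the set $S\cup S_i$ is the support of a member of $\mathcal M$; * *simple* if it is bounded and, whenever $\mathbf r^i\in\mathcal M$ and the sequence $(\mathcal M-\mathbf r^i)$ converges, its limit is $\mathcal M-\mathbf r$ for some $\mathbf r\in FIN(\mathbb N)$. A set $L\subset\mathcal M$ is *independent for* $\mathcal M$ if for every $L_1\subset L$ there is $\mathcal N\in\Theta(\mathcal M)$ with $L\cap\mathcal N=L_1$. The label $\mathcal M$ is *non-null* if for every $n$ it has a finite independent set with at least $n$ elements, and *non-tame* if there is an infinite $L\subset\mathcal M$ all of whose finite subsets are independent for $\mathcal M$. A *subshift* is a closed subset $X$ of $\{0,1\}^{\mathbb Z}$, invariant under the shift $(Sx)_t=x_{t+1}$ and its inverse. It is *topologically transitive* if for all nonempty open $U,V\subset X$ there is $n\in\mathbb Z$ with $S^nU\cap V\ne\emptyset$. It is *WAP* (weakly almost periodic) if every element of its enveloping semigroup, the closure of $\{S^n:n\in\mathbb Z\}$ in $X^X$ for pointwise convergence,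 is continuous. A set $K\subset\mathbb Z$ is *independent for* $X$ if the projection $X\to\{0,1\}^K$ is surjective. $X$ is *null* if there is a finite bound on the size of its independent sets, and *tame* if it has no infinite independent set. An *expansion system* consists of an integer $b\ge3$, an odd function $k:\mathbb Z\to\mathbb Z$ with $k(n+1)>b\sum_{i=0}^nk(i)$ for all $n\ge0$ and $k(1)\ge b+1$, and a partition of $\{1,2,\dots\}$ into infinite sets $D_1,D_2,\dots$ with $\min D_\ell<\min D_{\ell+1}$. An expansion of $t\in\mathbb Z$ is a representation $t=k(j_1)+\dots+k(j_r)$ with $r\ge 0$ and $|j_1|>\dots>|j_r|>0$; it is unique if it exists. Its length vector $\mathbf r(t)$ is given by $\mathbf r(t)_\ell=\#\{i:|j_i|\in D_\ell\}$. For a label $\mathcal M$ let $A[\mathcal M]$ be the set of integers $t$ that have an expansion with $\mathbf r(t)\in\mathcal M$, and let $A_+[\mathcal M]$ be the set of those $t\in A[\mathcal M]$ that are sums of finite subsets of $k(\mathbb Z_{\geq 0})$. Let $X(\mathcal M)$ and $X_+(\mathcal M)$ be the orbit closures under the shift, in $\{0,1\}^{\mathbb Z}$, of the characteristic functions of $A[\mathcal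 M]$ and $A_+[\mathcal M]$. **Statement.** (a) There are labels that are simple, finitary and non-null. For every such label $\mathcal M$ and every expansion system, the subshifts $X(\mathcal M)$ and $X_+(\mathcal M)$ are topologically transitive, WAP and not null. In particular there are topologically transitive WAP subshifts that are not null (which answers a question of Downarowicz). (b) There are labels of finite type that are non-tame. For every such label $\mathcal M$ and every expansion system, the subshifts $X(\mathcal M)$ and $X_+(\mathcal M)$ are topologically transitive, not tame and not WAP. In particular there are topologically transitive subshifts that are neither tame nor WAP. -/

import Mathlib

open Set Filter Topology
open SymbolicDynamics.FullShift (Subshift shift)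

namespace LabeledSubshift

/-! ### Dynamics -/

/-- The enveloping semigroup of an action of `Γ` on `X`: the closure of the set of translations
in `X → X`, with the topology of pointwise convergence. -/
def envelopingSemigroup (Γ X : Type*) [AddMonoid Γ] [AddAction Γ X] [TopologicalSpace X] :
    Set (X → X) :=
  closure (Set.range fun (g : Γ) (x : X) => g +ᵥ x)

/-- Weakly almost periodic: every element of the enveloping semigroup is continuous. -/
def IsWAP (Γ X : Type*) [AddMonoid Γ] [AddAction Γ X] [TopologicalSpace X] : Prop :=
  ∀ p ∈ envelopingSemigroup Γ X, Continuous p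

/-- The action of `ℤ` on a subshift generated by the shift `S`: here `n +ᵥ x = Sⁿ x`, that is
`(n +ᵥ x) t = x (n + t)`. -/
instance subshiftAction (Y : Subshift Bool ℤ) : AddAction ℤ Y.carrier where
  vadd n y := ⟨shift n y.1, Y.mapsTo n y.2⟩
  zero_vadd y := Subtype.ext (by
    change shift (0 : ℤ) y.1 = y.1
    exact SymbolicDynamics.FullShift.shift_zero y.1)
  add_vadd m n y := Subtype.ext (by
    change shift (m + n) y.1 = shift m (shift n y.1)
    rw [add_comm, SymbolicDynamics.FullShift.shift_add])

/-- A set `K` of coordinates is independent for a subshift if the coordinate projection of the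
subshift to `{0,1}^K` is surjective. -/
def IsIndependentCoord (Y : Subshift Bool ℤ) (K : Set ℤ) : Prop :=
  Function.Surjective fun (y : Y.carrier) (k : K) => y.1 k

/-- A subshift is null if there is a finite bound on the size of its independent sets. -/
def IsNull (Y : Subshift Bool ℤ) : Prop :=
  ∃ n : ℕ, ∀ K : Set ℤ, IsIndependentCoord Y K → K.encard ≤ n

/-- A subshift is tame if it has no infinite independent set. -/
def IsTame (Y : Subshift Bool ℤ) : Prop :=
  ∀ K : Set ℤ, IsIndependentCoord Y K → K.Finite

/-- The orbit closure of a point of `{0,1}^ℤ`. -/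
def orbitClosure (x : ℤ → Bool) : Subshift Bool ℤ where
  carrier := closure (Set.range fun n : ℤ => shift n x)
  isClosed := isClosed_closure
  mapsTo g := by
    apply MapsTo.closure _ (SymbolicDynamics.FullShift.continuous_shift g)
    rintro _ ⟨n, rfl⟩
    exact ⟨n + g, SymbolicDynamics.FullShift.shift_add n g x⟩

/-! ### Labels -/

/-- `FIN(ℕ)`: nonnegative integer vectors of finite support, indexed by the positive integers,
with pointwise addition and order. -/
abbrev NVec : Type := ℕ+ →₀ ℕ

/-- A label is a hereditary set of `ℕ`-vectors. -/
abbrev Label : Type := LowerSet NVec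

/-- The boxes `B_N`: vectors supported on `[1, N]` with entries at most `N`, where `B_0` is empty
by convention. -/
def box (N : ℕ) : Set NVec :=
  {m | 0 < N ∧ ∀ l : ℕ+, m l ≤ N ∧ (N < (l : ℕ) → m l = 0)}

theorem box_mono {N N' : ℕ} (h : N ≤ N') : box N ⊆ box N' := fun _ hm =>
  ⟨hm.1.trans_le h, fun l => ⟨(hm.2 l).1.trans h, fun hl => (hm.2 l).2 (h.trans_lt hl)⟩⟩

theorem exists_mem_box (m : NVec) : ∃ N, m ∈ box N := by
  refine ⟨1 + ∑ l ∈ m.support, (m l + (l : ℕ)), by omega, fun l => ?_⟩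
  by_cases hl : l ∈ m.support
  · have := Finset.single_le_sum (f := fun l : ℕ+ => m l + (l : ℕ)) (fun _ _ => Nat.zero_le _) hl
    constructor
    · omega
    · intro h
      omega
  · rw [Finsupp.notMem_support_iff] at hl
    simp [hl]

/-- The numbers `2^{-N}` over those `N` for which the two labels agree on `B_N`. -/
def agreeRadii (M₁ M₂ : Label) : Set ℝ :=
  {x | ∃ N : ℕ, x = (1 / 2 : ℝ) ^ N ∧ (M₁ : Set NVec) ∩ box N = (M₂ : Set NVec) ∩ box N}

theorem agreeRadii_nonempty (M₁ M₂ : Label) : (agreeRadii M₁ M₂).Nonempty :=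
  ⟨_, 0, rfl, by simp [box]⟩

theorem agreeRadii_pos {M₁ M₂ : Label} {x : ℝ} (hx : x ∈ agreeRadii M₁ M₂) : 0 < x := by
  obtain ⟨N, rfl, -⟩ := hx
  positivity

theorem agreeRadii_bddBelow (M₁ M₂ : Label) : BddBelow (agreeRadii M₁ M₂) :=
  ⟨0, fun _ hx => (agreeRadii_pos hx).le⟩

/-- The space of labels with the ultrametric
`d(M₁, M₂) = inf {2^{-N} : M₁ ∩ B_N = M₂ ∩ B_N}`. -/
noncomputable instance labelMetric : MetricSpace Label where
  dist M₁ M₂ := sInf (agreeRadii M₁ M₂)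
  dist_self M := by
    refine le_antisymm (le_of_forall_pos_le_add fun ε hε => ?_)
      (Real.sInf_nonneg fun _ hx => (agreeRadii_pos hx).le)
    obtain ⟨N, hN⟩ := exists_pow_lt_of_lt_one hε (by norm_num : (1 / 2 : ℝ) < 1)
    rw [zero_add]
    exact (csInf_le (agreeRadii_bddBelow M M) ⟨N, rfl, rfl⟩).trans hN.le
  dist_comm M₁ M₂ := by
    congr 1
    ext x
    simp only [agreeRadii, mem_ofPred_eq, eq_comm]
  dist_triangle M₁ M₂ M₃ := by
    have key : ∀ a ∈ agreeRadii M₁ M₂, ∀ b ∈ agreeRadii M₂ M₃,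
        sInf (agreeRadii M₁ M₃) ≤ a + b := by
      intro a ha b hb
      have ha0 := agreeRadii_pos ha
      have hb0 := agreeRadii_pos hb
      obtain ⟨N, rfl, h⟩ := ha
      obtain ⟨N', rfl, h'⟩ := hb
      rcases le_total N N' with hN | hN
      · refine (csInf_le (agreeRadii_bddBelow _ _) ⟨N, rfl, ?_⟩).trans
          (le_add_of_nonneg_right hb0.le)
        rw [h, ← inter_eq_self_of_subset_right (box_mono hN), ← inter_assoc, h', inter_assoc]
      · refine (csInf_le (agreeRadii_bddBelow _ _) ⟨N', rfl, ?_⟩).trans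
          (le_add_of_nonneg_left ha0.le)
        rw [← h', ← inter_eq_self_of_subset_right (box_mono hN), ← inter_assoc, h, inter_assoc]
    have h1 : ∀ b ∈ agreeRadii M₂ M₃,
        sInf (agreeRadii M₁ M₃) - b ≤ sInf (agreeRadii M₁ M₂) := fun b hb =>
      le_csInf (agreeRadii_nonempty _ _) fun a ha => by linarith [key a ha b hb]
    have h2 : sInf (agreeRadii M₁ M₃) - sInf (agreeRadii M₁ M₂) ≤ sInf (agreeRadii M₂ M₃) :=
      le_csInf (agreeRadii_nonempty _ _) fun b hb => by linarith [h1 b hb]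
    linarith
  eq_of_dist_eq_zero {M₁ M₂} h := by
    change sInf (agreeRadii M₁ M₂) = 0 at h
    ext m
    obtain ⟨N, hN⟩ := exists_mem_box m
    have hlt : sInf (agreeRadii M₁ M₂) < (1 / 2 : ℝ) ^ N := by
      rw [h]
      positivity
    obtain ⟨_, ⟨N', rfl, hag⟩, hN'⟩ := exists_lt_of_csInf_lt (agreeRadii_nonempty _ _) hlt
    have hle : N ≤ N' := by
      by_contra! hcon
      exact absurd hN' (not_lt.2 (pow_le_pow_of_le_one (by norm_num) (by norm_num) hcon.le))
    have hm := Set.ext_iff.1 hag m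
    simpa [box_mono hle hN] using hm

/-- `M - r = {w : w + r ∈ M}`. -/
def translate (M : Label) (r : NVec) : Label where
  carrier := {w | w + r ∈ M}
  lower' _ _ hba ha := M.lower (add_le_add_left hba r) ha

/-- `Θ(M)`: the closure of `{M - r}` in the space of labels. -/
def orbitClosureLabel (M : Label) : Set Label :=
  closure (Set.range fun r : NVec => translate M r)

/-- `Supp M`, the family of supports of the vectors of `M`. -/
def supports (M : Label) : Set (Finset ℕ+) :=
  {F | ∃ m ∈ M, m.support = F}

def IsBounded (M : Label) : Prop :=
  ∃ μ : ℕ+ → ℕ, ∀ m ∈ M, ∀ l, m l ≤ μ l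

/-- Finite type: no infinite strictly increasing sequence of vectors. -/
def IsFiniteType (M : Label) : Prop :=
  ¬ ∃ m : ℕ → NVec, StrictMono m ∧ ∀ i, m i ∈ M

def IsFinitary (M : Label) : Prop :=
  IsBounded M ∧ ∀ F : ℕ → Finset ℕ+, (⋃ i, (F i : Set ℕ+)).Infinite →
    {G : Finset ℕ+ | ∀ᶠ i in atTop, G ∪ F i ∈ supports M}.Finite

def IsSimple (M : Label) : Prop :=
  IsBounded M ∧ ∀ r : ℕ → NVec, (∀ i, r i ∈ M) → ∀ N : Label,
    Tendsto (fun i => translate M (r i)) atTop (𝓝 N) → ∃ s : NVec, N = translate M s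

/-- A set `L` of vectors of `M` is independent for the label `M` if each of its subsets is the
trace on `L` of some member of `Θ(M)`. -/
def IsIndependentLabel (M : Label) (L : Set NVec) : Prop :=
  L ⊆ (M : Set NVec) ∧ ∀ L₁ ⊆ L, ∃ N ∈ orbitClosureLabel M, L ∩ (N : Set NVec) = L₁

def IsNonNull (M : Label) : Prop :=
  ∀ n : ℕ, ∃ F : Finset NVec, IsIndependentLabel M (F : Set NVec) ∧ n ≤ F.card

def IsNonTame (M : Label) : Prop :=
  ∃ L : Set NVec, L.Infinite ∧ L ⊆ (M : Set NVec) ∧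
    ∀ F : Finset NVec, (F : Set NVec) ⊆ L → IsIndependentLabel M (F : Set NVec)

/-! ### Labeled subshifts -/

/-- The data that define labeled subshifts: a `b`-expanding function `k` with `b ≥ 3` and
`k 1 ≥ b + 1`, and a partition of the positive integers into infinite sets `D_1, D_2, …`
numbered by increasing minima. The partition is given by the map `cell` that sends `n` to the
index `l` with `n ∈ D_l`. -/
structure ExpansionSystem where
  b : ℕ
  three_le_b : 3 ≤ b
  k : ℤ → ℤ
  k_neg : ∀ n, k (-n) = -k n
  k_expanding : ∀ n : ℕ, (b : ℤ) * ∑ i ∈ Finset.range (n + 1), k (i : ℤ) < k ((n : ℤ) + 1)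
  k_one : (b : ℤ) + 1 ≤ k 1
  cell : ℕ+ → ℕ+
  cell_infinite : ∀ l, {n | cell n = l}.Infinite
  cell_min : ∀ l, ∃ n, cell n = l ∧ ∀ n', cell n' = l + 1 → n < n'

namespace ExpansionSystem

variable (E : ExpansionSystem)

/-- An expansion `t = k(j_1) + ⋯ + k(j_r)` with `|j_1| > ⋯ > |j_r| > 0`, encoded by the finite
set `J = {j_1, …, j_r}` of nonzero integers with distinct absolute values. -/
def IsExpansion (J : Finset ℤ) (t : ℤ) : Prop :=
  (∀ j ∈ J, j ≠ 0) ∧ Set.InjOn (fun j : ℤ => |j|) (J : Set ℤ) ∧ t = ∑ j ∈ J, E.k j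

/-- The length vector `χ(l(|j_1|)) + ⋯ + χ(l(|j_r|))` of an expansion. -/
noncomputable def lengthVector (J : Finset ℤ) : NVec :=
  ∑ j ∈ J, Finsupp.single (E.cell (Nat.toPNat' j.natAbs)) 1

/-- `IP_+(k)`: the sums of finite subsets of `k(ℤ_+)`. -/
def IPplus : Set ℤ :=
  {t | ∃ J : Finset ℤ, (∀ j ∈ J, 0 ≤ j) ∧ t = ∑ j ∈ J, E.k j}

/-- `A[M]`: the integers with an expansion whose length vector belongs to `M`
(expansions are unique). -/
def A (M : Label) : Set ℤ :=
  {t | ∃ J : Finset ℤ, E.IsExpansion J t ∧ E.lengthVector J ∈ M}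

/-- `A_+[M] = A[M] ∩ IP_+(k)`. -/
def Aplus (M : Label) : Set ℤ := E.A M ∩ E.IPplus

open Classical in
/-- `X(M)`: the orbit closure of the characteristic function of `A[M]`. -/
noncomputable def X (M : Label) : Subshift Bool ℤ :=
  orbitClosure fun t => decide (t ∈ E.A M)

open Classical in
/-- `X_+(M)`: the orbit closure of the characteristic function of `A_+[M]`. -/
noncomputable def Xplus (M : Label) : Subshift Bool ℤ :=
  orbitClosure fun t => decide (t ∈ E.Aplus M)

end ExpansionSystem

end LabeledSubshift

namespace LabeledSubshift

/-! ### Dynamics of orbit closures -/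

/-! Expansions carry addition of integers with well separated indices to addition of length vectors,
so dynamical questions about `A[M]` become questions about the label. Taking `A` or `A_+` only
changes which indices are allowed, hence the common form `restrictedA`. Transitivity is automatic
for an orbit closure.

Weak almost periodicity is Grothendieck's double limit condition: the iterated ultralimits of `s + t
∈ A` must agree (`isWAP_orbitClosure_of_isStable`). Every finitary label has finite type, so along
an ultrafilter an expansion is a constant part plus a part escaping to infinity. If the first
iterated limit holds, the expansion of `s + t` is a piece depending on `s` together with a piece
depending on `t`. Exchanging the limits then reduces to the same question for sums of vectors in
`M`, where simplicity represents both limits by vectors (`IsSimple.eventually_comm`,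
`isStable_restrictedA`).

Independence transfers through `isIndependentCoord_restrictedA`: a shift by an integer of length `r`
with very large indices shows the trace of `M - r` on prescribed vectors. Hence non-null and
non-tame labels give non-null and non-tame subshifts. A WAP subshift is tame (`IsWAP.isTame`), so
the non-tame ones are not WAP.

The labels themselves come from bipartite graphs: translating by a right vertex selects its
neighbours among the left vertices. Local finiteness gives a simple finitary label. Realizing all
subsets as neighbourhoods on larger and larger finite blocks gives non-nullness, and doing so on all
finite sets gives non-tameness. -/

instance (Y : Subshift Bool ℤ) : CompactSpace Y.carrier :=
  isCompact_iff_compactSpace.1 Y.isClosed.isCompact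

theorem coe_vadd_apply (Y : Subshift Bool ℤ) (n : ℤ) (y : Y.carrier) (t : ℤ) :
    (n +ᵥ y).1 t = y.1 (n + t) := rfl

/-- The base point of an orbit closure. -/
def orbitClosureBase (x : ℤ → Bool) : (orbitClosure x).carrier :=
  ⟨x, subset_closure ⟨0, SymbolicDynamics.FullShift.shift_zero x⟩⟩

theorem denseRange_orbitClosureBase (x : ℤ → Bool) :
    DenseRange fun n : ℤ => n +ᵥ orbitClosureBase x := by
  intro y
  rw [closure_subtype, ← range_comp]
  exact y.2

theorem eventually_coord_of_tendsto {ι : Type*} {Y : Subshift Bool ℤ} {l : Filter ι}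
    {f : ι → Y.carrier} {y : Y.carrier} (h : Tendsto f l (𝓝 y)) (t : ℤ) :
    ∀ᶠ i in l, (f i).1 t = y.1 t := by
  have h1 : Tendsto (fun i => (f i).1 t) l (𝓝 (y.1 t)) :=
    (((continuous_apply t).comp continuous_subtype_val).tendsto y).comp h
  rwa [nhds_discrete, tendsto_pure] at h1

theorem coord_eq_true_iff {ι : Type*} {Y : Subshift Bool ℤ} {l : Ultrafilter ι}
    {f : ι → Y.carrier} {y : Y.carrier} (h : Tendsto f l (𝓝 y)) (t : ℤ) :
    y.1 t = true ↔ ∀ᶠ i in (l : Filter ι), (f i).1 t = true := by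
  have h1 := eventually_coord_of_tendsto h t
  constructor
  · intro h2
    filter_upwards [h1] with i hi using hi.trans h2
  · intro h2
    obtain ⟨i, hi, hi'⟩ := (h1.and h2).exists
    exact hi.symm.trans hi'

theorem eventually_apply_coord_of_tendsto {ι : Type*} {Y : Subshift Bool ℤ} {l : Filter ι}
    {f : ι → Y.carrier → Y.carrier} {p : Y.carrier → Y.carrier} (h : Tendsto f l (𝓝 p))
    (y : Y.carrier) : Tendsto (fun i => f i y) l (𝓝 (p y)) :=
  ((continuous_apply y).tendsto p).comp h

theorem isTopologicallyTransitive_orbitClosure (x : ℤ → Bool) :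
    AddAction.IsTopologicallyTransitive ℤ (orbitClosure x).carrier := by
  refine ⟨fun {U V} hU hU' hV hV' => ?_⟩
  obtain ⟨m, hm⟩ := (denseRange_orbitClosureBase x).exists_mem_open hU hU'
  obtain ⟨n, hn⟩ := (denseRange_orbitClosureBase x).exists_mem_open hV hV'
  refine ⟨n - m, n +ᵥ orbitClosureBase x, ⟨_, hm, ?_⟩, hn⟩
  change (n - m) +ᵥ (m +ᵥ orbitClosureBase x) = _
  rw [vadd_vadd, sub_add_cancel]

/-- A set of integers is stable if membership of `s + t` satisfies the double limit condition
along all pairs of ultrafilters. -/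
def IsStable (A : Set ℤ) : Prop :=
  ∀ U V : Ultrafilter ℤ, (∀ᶠ s in (V : Filter ℤ), ∀ᶠ t in (U : Filter ℤ), s + t ∈ A) →
    ∀ᶠ t in (U : Filter ℤ), ∀ᶠ s in (V : Filter ℤ), s + t ∈ A

/-- Addition is commutative, so exchanging `U` and `V` turns one implication into the other. -/
theorem IsStable.iff {A : Set ℤ} (h : IsStable A) (U V : Ultrafilter ℤ) :
    (∀ᶠ s in (V : Filter ℤ), ∀ᶠ t in (U : Filter ℤ), s + t ∈ A) ↔
      ∀ᶠ t in (U : Filter ℤ), ∀ᶠ s in (V : Filter ℤ), s + t ∈ A := by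
  refine ⟨h U V, fun h' => ?_⟩
  have := h V U (by simpa only [add_comm] using h')
  simpa only [add_comm] using this

/-- An element `p` of the enveloping semigroup is a limit of shifts along some `U`. If orbit points
tend to `y` along `V`, the coordinates of `p y` and the limits of those of `p` at the orbit points
are the two iterated limits, equal by stability. -/
theorem isWAP_orbitClosure_of_isStable (x : ℤ → Bool) (h : IsStable {t | x t = true}) :
    IsWAP ℤ (orbitClosure x).carrier := by
  intro p hp
  obtain ⟨F, hF, hFp⟩ := mem_closure_iff_ultrafilter.1 hp
  let l := comap (fun (g : ℤ) (y : (orbitClosure x).carrier) => g +ᵥ y) (F : Filter _)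
  have hne : l.NeBot :=
    comap_neBot fun t ht => by
      obtain ⟨_, h1, g, rfl⟩ := Filter.nonempty_of_mem (inter_mem ht hF)
      exact ⟨g, h1⟩
  let U : Ultrafilter ℤ := Ultrafilter.of l
  have hUp : Tendsto (fun (g : ℤ) (y : (orbitClosure x).carrier) => g +ᵥ y) U (𝓝 p) :=
    (tendsto_comap.mono_left (Ultrafilter.of_le _)).mono_right hFp
  refine Continuous.subtype_mk (continuous_pi fun m => ?_) fun y => (p y).2
  -- Continuity of a coordinate of `p` is proved first for approach to `y` through the dense orbit.
  have key : ∀ y, ∀ᶠ s in comap (fun s : ℤ => s +ᵥ orbitClosureBase x) (𝓝 y),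
      (p (s +ᵥ orbitClosureBase x)).1 m = (p y).1 m := by
    intro y
    rw [← tendsto_pure, tendsto_iff_ultrafilter]
    intro V hV
    rw [tendsto_pure]
    have hVy : Tendsto (fun s : ℤ => s +ᵥ orbitClosureBase x) V (𝓝 y) :=
      tendsto_comap.mono_left hV
    have h1 : (p y).1 m = true ↔ ∀ᶠ t in (U : Filter ℤ), ∀ᶠ s in (V : Filter ℤ),
        s + (t + m) ∈ {t | x t = true} := by
      rw [coord_eq_true_iff (eventually_apply_coord_of_tendsto hUp y) m]
      refine eventually_congr (Eventually.of_forall fun t => ?_)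
      rw [coe_vadd_apply, coord_eq_true_iff hVy (t + m)]
      rfl
    have h2 : ∀ s : ℤ, (p (s +ᵥ orbitClosureBase x)).1 m = true ↔
        ∀ᶠ t in (U : Filter ℤ), s + (t + m) ∈ {t | x t = true} := by
      intro s
      rw [coord_eq_true_iff (eventually_apply_coord_of_tendsto hUp _) m]
      rfl
    have h3 : (p y).1 m = true ↔
        ∀ᶠ s in (V : Filter ℤ), (p (s +ᵥ orbitClosureBase x)).1 m = true := by
      simp only [h1, h2]
      -- The coordinate `m` is absorbed into `U` by translating it.
      exact (h.iff (U.map (· + m)) V).symm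
    cases hpy : (p y).1 m
    · rw [hpy] at h3
      have := mt h3.2 (by simp)
      rw [Ultrafilter.eventually_not.symm] at this
      simpa using this
    · exact h3.1 hpy
  rw [continuous_iff_continuousAt]
  intro y
  change Tendsto (fun y => (p y).1 m) (𝓝 y) (𝓝 ((p y).1 m))
  rw [nhds_discrete Bool, tendsto_pure]
  obtain ⟨W, hW, hWs⟩ := mem_comap.1 (key y)
  obtain ⟨W', hW', hWo, hyW⟩ := mem_nhds_iff.1 hW
  -- For `y'` near `y`, an orbit point close to both has the same coordinate of `p` as each of them.
  filter_upwards [hWo.mem_nhds hyW] with y' hy'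
  obtain ⟨W2, hW2, hW2s⟩ := mem_comap.1 (key y')
  obtain ⟨s, hs⟩ := (denseRange_orbitClosureBase x).exists_mem_open
    (isOpen_interior.inter hWo) ⟨y', mem_interior_iff_mem_nhds.2 hW2, hy'⟩
  have hs1 : s +ᵥ orbitClosureBase x ∈ W2 := interior_subset hs.1
  exact (hW2s hs1).symm.trans (hWs (hW' hs.2))

/-- On an infinite independent set `{n i}` there are points `x_j` whose coordinate at `n i` is the
truth value of `i ≤ j`. Its iterated limits in `i` and `j` differ, whereas continuity of a limit of
the shifts by `n i` would force them to agree. -/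
theorem IsWAP.isTame {Y : Subshift Bool ℤ} (h : IsWAP ℤ Y.carrier) : IsTame Y := by
  intro K hK
  by_contra hinf
  let n : ℕ ↪ K := Set.Infinite.natEmbedding K hinf
  have hx : ∀ j : ℕ, ∃ y : Y.carrier, ∀ i, y.1 (n i) = decide (i ≤ j) := by
    intro j
    obtain ⟨y, hy⟩ := hK fun k => decide (Function.invFun n k ≤ j)
    refine ⟨y, fun i => ?_⟩
    have := congrFun hy (n i)
    simpa [Function.leftInverse_invFun n.injective i] using this
  choose xs hxs using hx
  let U : Ultrafilter ℕ := hyperfilter ℕ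
  have hU : ∀ j : ℕ, ∀ᶠ i in (U : Filter ℕ), j < i := fun j =>
    (Nat.hyperfilter_le_atTop) (eventually_gt_atTop j)
  obtain ⟨x, -, hx⟩ := isCompact_univ.ultrafilter_le_nhds (U.map xs) (by simp)
  obtain ⟨p, -, hp⟩ := isCompact_univ.ultrafilter_le_nhds
    (U.map fun (i : ℕ) (y : Y.carrier) => (n i : ℤ) +ᵥ y) (by simp)
  have hx : Tendsto xs U (𝓝 x) := hx
  have hp : Tendsto (fun (i : ℕ) (y : Y.carrier) => (n i : ℤ) +ᵥ y) U (𝓝 p) := hp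
  have hpc : Continuous p :=
    h p (mem_closure_of_tendsto hp (Eventually.of_forall fun i => ⟨n i, rfl⟩))
  have h0 : ∀ y, (p y).1 0 = true ↔ ∀ᶠ i in (U : Filter ℕ), y.1 (n i) = true := by
    intro y
    rw [coord_eq_true_iff (eventually_apply_coord_of_tendsto hp y) 0]
    simp only [coe_vadd_apply, add_zero]
  have h1 : (p x).1 0 = true := by
    rw [h0]
    refine Eventually.of_forall fun i => ?_
    rw [coord_eq_true_iff hx]
    filter_upwards [hU i] with j hj
    simp [hxs, hj.le]
  rw [coord_eq_true_iff ((hpc.tendsto x).comp hx)] at h1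
  obtain ⟨j, hj⟩ := h1.exists
  obtain ⟨i, hi, hi'⟩ := (((h0 _).1 hj).and (hU j)).exists
  simp only [hxs, decide_eq_true_eq] at hi
  omega

/-- A set is independent for a subshift as soon as its finite subsets are. -/
theorem isIndependentCoord_of_finite {Y : Subshift Bool ℤ} {K : Set ℤ}
    (h : ∀ (F : Finset ℤ) (L : Set ℤ), (F : Set ℤ) ⊆ K →
      ∃ y : Y.carrier, ∀ t ∈ F, (y.1 t = true ↔ t ∈ L)) : IsIndependentCoord Y K := by
  classical
  intro z
  let L : Set ℤ := {t | ∃ ht : t ∈ K, z ⟨t, ht⟩ = true}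
  have hc : ∀ t : ℤ, IsClosed {y : Y.carrier | y.1 t = true ↔ t ∈ L} := fun t =>
    IsClosed.preimage (f := fun y : Y.carrier => y.1 t)
      ((continuous_apply t).comp continuous_subtype_val)
      (isClosed_discrete {b : Bool | b = true ↔ t ∈ L})
  -- Each prescribed coordinate is a closed condition, so compactness passes from finite subsets to
  -- `K`.
  have := CompactSpace.iInter_nonempty
    (fun k : K => hc k.1) (fun s => ?_)
  · obtain ⟨y, hy⟩ := this
    refine ⟨y, funext fun k => ?_⟩
    have hk : y.1 k.1 = true ↔ k.1 ∈ L := mem_iInter.1 hy k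
    have : k.1 ∈ L ↔ z k = true := ⟨fun ⟨_, h⟩ => h, fun h => ⟨k.2, h⟩⟩
    rw [this] at hk
    exact Bool.eq_iff_iff.2 hk
  · obtain ⟨y, hy⟩ := h (s.image (↑)) L (by simp)
    exact ⟨y, mem_iInter₂.2 fun k hk => hy _ (Finset.mem_image_of_mem _ hk)⟩

end LabeledSubshift

namespace LabeledSubshift

/-! ### Expansions -/

namespace ExpansionSystem

variable (E : ExpansionSystem)

/-- The finite sets of integers that encode expansions. -/
def IsDigitSet (J : Finset ℤ) : Prop :=
  (∀ j ∈ J, j ≠ 0) ∧ Set.InjOn (fun j : ℤ => |j|) (J : Set ℤ)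

theorem IsDigitSet.mono {J J' : Finset ℤ} (h : IsDigitSet J') (hJ : J ⊆ J') : IsDigitSet J :=
  ⟨fun j hj => h.1 j (hJ hj), h.2.mono (Finset.coe_subset.2 hJ)⟩

theorem IsDigitSet.eq_of_natAbs_eq {J : Finset ℤ} (h : IsDigitSet J) {i j : ℤ} (hi : i ∈ J)
    (hj : j ∈ J) (hij : i.natAbs = j.natAbs) : i = j :=
  h.2 hi hj (by simp only [Int.abs_eq_natAbs, hij])

theorem isDigitSet_of_pos {J : Finset ℤ} (h : ∀ j ∈ J, 0 < j) : IsDigitSet J :=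
  ⟨fun j hj => (h j hj).ne', fun i hi j hj hij => by
    simpa only [abs_of_pos (h i hi), abs_of_pos (h j hj)] using hij⟩

theorem disjoint_of_abs_lt {J J' : Finset ℤ} (hd : ∀ i ∈ J, ∀ j ∈ J', |i| < |j|) :
    Disjoint J J' :=
  Finset.disjoint_left.2 fun i hi hi' => (hd i hi i hi').ne rfl

/-- The integer represented by an expansion. -/
def value (J : Finset ℤ) : ℤ := ∑ j ∈ J, E.k j

theorem value_union {J J' : Finset ℤ} (h : Disjoint J J') :
    E.value (J ∪ J') = E.value J + E.value J' := Finset.sum_union h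

theorem lengthVector_union {J J' : Finset ℤ} (h : Disjoint J J') :
    E.lengthVector (J ∪ J') = E.lengthVector J + E.lengthVector J' := Finset.sum_union h

theorem lengthVector_mono {J J' : Finset ℤ} (h : J ⊆ J') :
    E.lengthVector J ≤ E.lengthVector J' := by
  classical
  rw [← Finset.union_sdiff_of_subset h, E.lengthVector_union Finset.disjoint_sdiff]
  exact le_add_of_nonneg_right (zero_le)

theorem lengthVector_strictMono : StrictMono E.lengthVector := by
  classical
  intro J J' h
  refine lt_of_le_of_ne (E.lengthVector_mono h.1) fun heq => ?_
  obtain ⟨j, hj, hj'⟩ := Finset.exists_of_ssubset h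
  have h1 : E.lengthVector (insert j J) ≤ E.lengthVector J :=
    heq ▸ E.lengthVector_mono (Finset.insert_subset hj h.1)
  rw [lengthVector, Finset.sum_insert hj'] at h1
  have := h1 (E.cell (Nat.toPNat' j.natAbs))
  simp [lengthVector] at this

theorem k_zero : E.k 0 = 0 := by
  have := E.k_neg 0
  simp at this
  omega

theorem le_sum_k (n : ℕ) : (n : ℤ) ≤ ∑ i ∈ Finset.range (n + 1), E.k (i : ℤ) := by
  induction n with
  | zero => simp [E.k_zero]
  | succ n ih =>
    rw [Finset.sum_range_succ]
    have h1 := E.k_expanding n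
    have h2 : (0 : ℤ) ≤ (E.b : ℤ) * ∑ i ∈ Finset.range (n + 1), E.k (i : ℤ) :=
      mul_nonneg (by positivity) (by omega)
    push_cast
    omega

theorem three_mul_sum_k_lt (n : ℕ) :
    3 * ∑ i ∈ Finset.range (n + 1), E.k (i : ℤ) < E.k ((n : ℤ) + 1) := by
  refine lt_of_le_of_lt (mul_le_mul_of_nonneg_right ?_ ?_) (E.k_expanding n)
  · exact_mod_cast E.three_le_b
  · exact le_trans (by positivity) (E.le_sum_k n)

theorem k_nonneg (n : ℕ) : 0 ≤ E.k n := by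
  cases n with
  | zero => simp [E.k_zero]
  | succ n =>
    have := E.three_mul_sum_k_lt n
    have := E.le_sum_k n
    push_cast
    omega

/-- `D` stands for a difference of two digit sequences with values in `{-1, 0, 1}`. The top term
exceeds three times the sum of the lower `k i`, the rest cancels at most twice that sum, and what
remains exceeds the sum, hence `N - 1`. -/
theorem le_abs_sum_mul_k (D : ℕ → ℤ) (hD : ∀ i, |D i| ≤ 2) (N : ℕ) (hN : D N ≠ 0) :
    (N : ℤ) ≤ |∑ i ∈ Finset.range (N + 1), D i * E.k i| := by
  cases N with
  | zero => exact abs_nonneg _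
  | succ n =>
    rw [Finset.sum_range_succ]
    have h1 : |∑ i ∈ Finset.range (n + 1), D i * E.k i| ≤
        2 * ∑ i ∈ Finset.range (n + 1), E.k (i : ℤ) := by
      refine (Finset.abs_sum_le_sum_abs _ _).trans ?_
      rw [Finset.mul_sum]
      refine Finset.sum_le_sum fun i _ => ?_
      rw [abs_mul, abs_of_nonneg (E.k_nonneg i)]
      exact mul_le_mul_of_nonneg_right (hD i) (E.k_nonneg i)
    have h2 : E.k ((n + 1 : ℕ) : ℤ) ≤ |D (n + 1) * E.k ((n + 1 : ℕ) : ℤ)| := by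
      rw [abs_mul, abs_of_nonneg (E.k_nonneg _)]
      exact le_mul_of_one_le_left (E.k_nonneg _) (Int.one_le_abs hN)
    have h3 := E.three_mul_sum_k_lt n
    have h4 := E.le_sum_k n
    have h5 := abs_sub_abs_le_abs_add (D (n + 1) * E.k ((n + 1 : ℕ) : ℤ))
      (∑ i ∈ Finset.range (n + 1), D i * E.k i)
    rw [add_comm (D (n + 1) * _)] at h5
    push_cast at *
    omega

/-- The coefficient of `k i`, for `i ≥ 0`, in the expansion encoded by `J`. -/
def digit (J : Finset ℤ) (i : ℕ) : ℤ := ∑ j ∈ J, if j.natAbs = i then j.sign else 0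

theorem k_eq_sign_mul (j : ℤ) : E.k j = j.sign * E.k (j.natAbs : ℤ) := by
  rcases lt_trichotomy j 0 with h | rfl | h
  · rw [Int.sign_eq_neg_one_of_neg h, Int.ofNat_natAbs_of_nonpos h.le, E.k_neg]
    ring
  · simp [E.k_zero]
  · rw [Int.sign_eq_one_of_pos h, Int.natAbs_of_nonneg h.le, one_mul]

theorem value_eq_sum_digit {J : Finset ℤ} {N : ℕ} (hN : ∀ j ∈ J, j.natAbs < N) :
    E.value J = ∑ i ∈ Finset.range N, digit J i * E.k i := by
  simp only [digit, Finset.sum_mul]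
  rw [Finset.sum_comm]
  refine Finset.sum_congr rfl fun j hj => ?_
  simp only [ite_mul, zero_mul]
  rw [Finset.sum_ite_eq, if_pos (Finset.mem_range.2 (hN j hj)), ← E.k_eq_sign_mul]

theorem IsDigitSet.digit_eq {J : Finset ℤ} (h : IsDigitSet J) {j : ℤ} (hj : j ∈ J) :
    digit J j.natAbs = j.sign := by
  rw [digit, Finset.sum_eq_single_of_mem j hj, if_pos rfl]
  intro i hi hij
  rw [if_neg fun he => hij (h.eq_of_natAbs_eq hi hj he)]

theorem digit_eq_zero {J : Finset ℤ} {i : ℕ} (h : ∀ j ∈ J, j.natAbs ≠ i) : digit J i = 0 :=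
  Finset.sum_eq_zero fun j hj => if_neg (h j hj)

theorem IsDigitSet.abs_digit_le {J : Finset ℤ} (h : IsDigitSet J) (i : ℕ) :
    |digit J i| ≤ 1 := by
  by_cases hi : ∃ j ∈ J, j.natAbs = i
  · obtain ⟨j, hj, rfl⟩ := hi
    rw [h.digit_eq hj]
    rcases lt_trichotomy j 0 with h | rfl | h
    · rw [Int.sign_eq_neg_one_of_neg h]; simp
    · simp
    · rw [Int.sign_eq_one_of_pos h]; simp
  · push Not at hi
    simp [digit_eq_zero hi]

theorem IsDigitSet.mem_of_digit_eq {J : Finset ℤ} (h : IsDigitSet J) {j : ℤ} (hj : j ≠ 0)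
    (hd : digit J j.natAbs = j.sign) : j ∈ J := by
  by_cases hi : ∃ i ∈ J, i.natAbs = j.natAbs
  · obtain ⟨i, hi, hij⟩ := hi
    rw [← hij, h.digit_eq hi] at hd
    have : i = j := by rw [← Int.sign_mul_natAbs i, ← Int.sign_mul_natAbs j, hd, hij]
    exact this ▸ hi
  · push Not at hi
    rw [digit_eq_zero hi] at hd
    exact absurd (Int.sign_eq_zero_iff_zero.1 hd.symm) hj

/-- Two expansions of nearby integers have the same high order terms. -/
theorem mem_of_abs_value_sub_lt {J J' : Finset ℤ} (h : IsDigitSet J) (h' : IsDigitSet J') {n : ℤ}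
    (hn : |E.value J - E.value J'| < n) {j : ℤ} (hj : j ∈ J) (hnj : n ≤ |j|) : j ∈ J' := by
  by_contra hj'
  obtain ⟨N, hN⟩ : ∃ N : ℕ, ∀ j ∈ J ∪ J', j.natAbs < N :=
    ⟨(J ∪ J').sup Int.natAbs + 1, fun j hj => Nat.lt_succ_of_le (Finset.le_sup hj)⟩
  let D : ℕ → ℤ := fun i => digit J i - digit J' i
  let s := (Finset.range N).filter fun i => D i ≠ 0
  have hs : j.natAbs ∈ s := by
    refine Finset.mem_filter.2 ⟨Finset.mem_range.2 (hN j (Finset.mem_union_left _ hj)), fun h0 => ?_⟩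
    have h1 : digit J j.natAbs = digit J' j.natAbs := sub_eq_zero.1 h0
    rw [h.digit_eq hj] at h1
    exact hj' (h'.mem_of_digit_eq (h.1 j hj) h1.symm)
  -- At the top index `m ≥ |j|` where the digits differ, the leading term makes the difference of
  -- values at least `m`, hence at least `n`.
  obtain ⟨m, hm, hmax⟩ := s.exists_max_image id ⟨_, hs⟩
  have hmN : m < N := Finset.mem_range.1 (Finset.mem_filter.1 hm).1
  have hD : E.value J - E.value J' = ∑ i ∈ Finset.range (m + 1), D i * E.k i := by
    rw [E.value_eq_sum_digit fun j hj => hN j (Finset.mem_union_left _ hj),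
      E.value_eq_sum_digit fun j hj => hN j (Finset.mem_union_right _ hj),
      ← Finset.sum_sub_distrib]
    simp only [← sub_mul]
    refine (Finset.sum_subset (Finset.range_subset_range.2 hmN) fun i hi hi' => ?_).symm
    have : D i = 0 := by
      by_contra h0
      exact hi' (Finset.mem_range.2 (Nat.lt_succ_of_le
        (hmax i (Finset.mem_filter.2 ⟨hi, h0⟩))))
    change D i * _ = 0
    rw [this, zero_mul]
  have h1 := E.le_abs_sum_mul_k D (fun i => ?_) m (Finset.mem_filter.1 hm).2
  · rw [← hD] at h1
    have h2 : j.natAbs ≤ m := hmax _ hs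
    rw [Int.abs_eq_natAbs j] at hnj
    omega
  · have h1 := abs_sub (digit J i) (digit J' i)
    have h2 := h.abs_digit_le i
    have h3 := h'.abs_digit_le i
    change |digit J i - digit J' i| ≤ 2
    linarith

theorem eq_of_value_eq {J J' : Finset ℤ} (h : IsDigitSet J) (h' : IsDigitSet J')
    (hv : E.value J = E.value J') : J = J' := by
  have key : ∀ {I I' : Finset ℤ}, IsDigitSet I → IsDigitSet I' → E.value I = E.value I' →
      I ⊆ I' := fun {I I'} hI hI' hv j hj =>
    -- The threshold `1` reaches every index, since none is zero.
    E.mem_of_abs_value_sub_lt (n := 1) hI hI' (by simp [hv]) hj (Int.one_le_abs (hI.1 j hj))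
  exact (key h h' hv).antisymm (key h' h hv.symm)

/-- Every vector is the length vector of an expansion with large positive indices. -/
theorem exists_lengthVector_eq (r : NVec) :
    ∀ N : ℤ, ∃ J : Finset ℤ, (∀ j ∈ J, 0 < j ∧ N < j) ∧ E.lengthVector J = r := by
  classical
  have hadd : ∀ r s : NVec,
      (∀ N : ℤ, ∃ J : Finset ℤ, (∀ j ∈ J, 0 < j ∧ N < j) ∧ E.lengthVector J = r) →
      (∀ N : ℤ, ∃ J : Finset ℤ, (∀ j ∈ J, 0 < j ∧ N < j) ∧ E.lengthVector J = s) →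
      ∀ N : ℤ, ∃ J : Finset ℤ, (∀ j ∈ J, 0 < j ∧ N < j) ∧ E.lengthVector J = r + s := by
    intro r s hr hs N
    obtain ⟨J, hJ, hJr⟩ := hr N
    obtain ⟨B, hB⟩ := J.bddAbove
    -- The second summand is placed above the first, which makes the index sets disjoint.
    obtain ⟨J', hJ', hJs⟩ := hs (max N B)
    refine ⟨J ∪ J', fun j hj => ?_, ?_⟩
    · rcases Finset.mem_union.1 hj with h | h
      · exact hJ j h
      · exact ⟨(hJ' j h).1, (le_max_left _ _).trans_lt (hJ' j h).2⟩
    · rw [E.lengthVector_union, hJr, hJs]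
      exact Finset.disjoint_left.2 fun i hi hi' =>
        absurd ((le_max_right _ _).trans_lt (hJ' i hi').2) (not_lt.2 (hB hi))
  induction r using Finsupp.induction_linear with
  | zero => exact fun N => ⟨∅, by simp, by simp [lengthVector]⟩
  | add f g hf hg => exact hadd f g hf hg
  | single l n =>
    induction n with
    | zero => exact fun N => ⟨∅, by simp, by simp [lengthVector]⟩
    | succ n ih =>
      rw [Finsupp.single_add]
      refine hadd _ _ ih fun N => ?_
      obtain ⟨m, hm, hmN⟩ := (E.cell_infinite l).exists_gt (Nat.toPNat' N.toNat)
      refine ⟨{(m : ℤ)}, fun j hj => ?_, ?_⟩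
      · rw [Finset.mem_singleton] at hj
        have h1 := PNat.coe_lt_coe _ _ |>.2 hmN
        have h2 : N.toNat ≤ (Nat.toPNat' N.toNat : ℕ) := by
          rw [Nat.toPNat'_coe]
          split_ifs <;> omega
        have h3 := m.pos
        omega
      · have : Nat.toPNat' (m : ℕ) = m := PNat.coe_toPNat' m
        simp only [lengthVector, Finset.sum_singleton, Int.natAbs_natCast, this]
        rw [hm]

/-- The integers with an expansion whose indices satisfy `Q` and whose length vector belongs
to `M`. -/
def restrictedA (Q : ℤ → Prop) (M : Label) : Set ℤ :=
  {t | ∃ J : Finset ℤ, IsDigitSet J ∧ (∀ j ∈ J, Q j) ∧ E.lengthVector J ∈ M ∧ t = E.value J}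

theorem A_eq (M : Label) : E.A M = E.restrictedA (fun _ => True) M := by
  ext t
  constructor
  · rintro ⟨J, ⟨h1, h2, h3⟩, h4⟩
    exact ⟨J, ⟨h1, h2⟩, fun _ _ => trivial, h4, h3⟩
  · rintro ⟨J, h, -, h4, h3⟩
    exact ⟨J, ⟨h.1, h.2, h3⟩, h4⟩

/-- Since `k 0 = 0`, the index `0` can be dropped from a sum over nonnegative indices. Uniqueness
then identifies what is left with the given expansion. -/
theorem Aplus_eq (M : Label) : E.Aplus M = E.restrictedA (fun j => 0 < j) M := by
  classical
  ext t
  constructor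
  · rintro ⟨⟨J, ⟨h1, h2, h3⟩, h4⟩, J', hJ', ht⟩
    have hpos : ∀ j ∈ J'.erase 0, 0 < j := fun j hj =>
      lt_of_le_of_ne (hJ' j (Finset.mem_of_mem_erase hj)) (Finset.ne_of_mem_erase hj).symm
    have hv : E.value J = E.value (J'.erase 0) := by
      rw [value, ← h3, ht, value]
      refine (Finset.sum_subset (Finset.erase_subset 0 J') fun j hj hj' => ?_).symm
      have : j = 0 := by
        by_contra h0
        exact hj' (Finset.mem_erase.2 ⟨h0, hj⟩)
      rw [this, E.k_zero]
    obtain rfl := E.eq_of_value_eq ⟨h1, h2⟩ (isDigitSet_of_pos hpos) hv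
    exact ⟨_, ⟨h1, h2⟩, hpos, h4, h3⟩
  · rintro ⟨J, h, hJ, h4, h3⟩
    exact ⟨⟨J, ⟨h.1, h.2, h3⟩, h4⟩, J, fun j hj => (hJ j hj).le, h3⟩

end ExpansionSystem

end LabeledSubshift

namespace LabeledSubshift

/-! ### The space of labels -/

theorem inter_box_eq_of_dist_lt {M₁ M₂ : Label} {n : ℕ} (h : dist M₁ M₂ < (1 / 2 : ℝ) ^ n) :
    (M₁ : Set NVec) ∩ box n = (M₂ : Set NVec) ∩ box n := by
  obtain ⟨_, ⟨m, rfl, hm⟩, hlt⟩ := exists_lt_of_csInf_lt (agreeRadii_nonempty M₁ M₂) h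
  have hle : n ≤ m := by
    by_contra! hcon
    exact absurd hlt (not_lt.2 (pow_le_pow_of_le_one (by norm_num) (by norm_num) hcon.le))
  rw [← inter_eq_self_of_subset_right (box_mono hle), ← inter_assoc, hm, inter_assoc]

theorem dist_le_of_inter_box_eq {M₁ M₂ : Label} {n : ℕ}
    (h : (M₁ : Set NVec) ∩ box n = (M₂ : Set NVec) ∩ box n) : dist M₁ M₂ ≤ (1 / 2 : ℝ) ^ n :=
  csInf_le (agreeRadii_bddBelow M₁ M₂) ⟨n, rfl, h⟩

theorem finite_setOf_support_subset (s : Finset ℕ+) (μ : ℕ+ → ℕ) :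
    {m : NVec | m.support ⊆ s ∧ ∀ l, m l ≤ μ l}.Finite := by
  refine (Set.finite_Icc (0 : NVec) (Finsupp.indicator s fun l _ => μ l)).subset ?_
  rintro m ⟨hs, hm⟩
  refine ⟨zero_le, fun l => ?_⟩
  by_cases hl : l ∈ s
  · rw [Finsupp.indicator_of_mem hl]
    exact hm l
  · rw [Finsupp.notMem_support_iff.1 fun h => hl (hs h)]
    exact Nat.zero_le _

theorem finite_box (n : ℕ) : (box n).Finite := by
  refine (finite_setOf_support_subset (Finset.Iic (Nat.toPNat' n)) fun _ => n).subset ?_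
  rintro m ⟨hn, hm⟩
  refine ⟨fun l hl => ?_, fun l => (hm l).1⟩
  rw [Finset.mem_Iic, ← PNat.coe_le_coe, Nat.toPNat'_coe, if_pos hn]
  by_contra! h
  exact Finsupp.mem_support_iff.1 hl ((hm l).2 h)

theorem exists_translate_of_mem_orbitClosureLabel {M N : Label} (h : N ∈ orbitClosureLabel M)
    (F : Finset NVec) : ∃ r, ∀ m ∈ F, m + r ∈ M ↔ m ∈ N := by
  choose c hc using exists_mem_box
  obtain ⟨_, ⟨r, rfl⟩, hr⟩ := Metric.mem_closure_iff.1 h ((1 / 2 : ℝ) ^ F.sup c) (by positivity)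
  refine ⟨r, fun m hm => ?_⟩
  have h1 := Set.ext_iff.1 (inter_box_eq_of_dist_lt hr) m
  have h2 : m ∈ box (F.sup c) := box_mono (Finset.le_sup hm) (hc m)
  simp only [mem_inter_iff, h2, and_true] at h1
  exact h1.symm

/-- Boxes are finite, so some `r i` has a translate agreeing with the ultralimit on `box n`.
Choosing one for each `n` gives a convergent sequence, to which simplicity applies. -/
theorem IsSimple.exists_ultralimit {M : Label} (hM : IsSimple M) {ι : Type*} (U : Ultrafilter ι)
    (r : ι → NVec) (hr : ∀ᶠ i in (U : Filter ι), r i ∈ M) :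
    ∃ s, ∀ w, w + s ∈ M ↔ ∀ᶠ i in (U : Filter ι), w + r i ∈ M := by
  let N : Label :=
    { carrier := {w | ∀ᶠ i in (U : Filter ι), w + r i ∈ M}
      lower' := fun a b hba ha => ha.mono fun i hi => M.lower (add_le_add_left hba _) hi }
  have hN : ∀ w, w ∈ N ↔ ∀ᶠ i in (U : Filter ι), w + r i ∈ M := fun w => Iff.rfl
  have hseq : ∀ n : ℕ, ∃ i, r i ∈ M ∧ ∀ w ∈ box n, (w + r i ∈ M ↔ w ∈ N) := by
    intro n
    refine (hr.and ((finite_box n).eventually_all.2 fun w _ => ?_)).exists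
    by_cases hw : w ∈ N
    · filter_upwards [(hN w).1 hw] with i hi using iff_of_true hi hw
    · have h1 := mt (hN w).2 hw
      rw [← Ultrafilter.eventually_not] at h1
      filter_upwards [h1] with i hi using iff_of_false hi hw
  choose q hq hqN using hseq
  obtain ⟨s, hs⟩ := hM.2 (fun n => r (q n)) hq N <| by
    rw [Metric.tendsto_atTop]
    intro ε hε
    obtain ⟨n, hn⟩ := exists_pow_lt_of_lt_one hε (by norm_num : (1 / 2 : ℝ) < 1)
    refine ⟨n, fun m hm => (dist_le_of_inter_box_eq ?_).trans_lt hn⟩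
    ext w
    refine and_congr_left fun hw => ?_
    exact hqN m w (box_mono hm hw)
  refine ⟨s, fun w => ?_⟩
  rw [← hN, hs]
  rfl

/-- Iterated ultralimits of membership of sums in a simple label can be exchanged. -/
theorem IsSimple.eventually_comm {M : Label} (hM : IsSimple M) {α β : Type*} (V : Ultrafilter α)
    (U : Ultrafilter β) (p : α → NVec) (q : β → NVec)
    (h : ∀ᶠ a in (V : Filter α), ∀ᶠ b in (U : Filter β), p a + q b ∈ M) :
    ∀ᶠ b in (U : Filter β), ∀ᶠ a in (V : Filter α), p a + q b ∈ M := by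
  have hp : ∀ᶠ a in (V : Filter α), p a ∈ M := h.mono fun a ha =>
    ha.exists.elim fun b hb => M.lower (le_add_of_nonneg_right zero_le) hb
  have hq : ∀ᶠ b in (U : Filter β), q b ∈ M := h.exists.elim fun a ha =>
    ha.mono fun b hb => M.lower (le_add_of_nonneg_left zero_le) hb
  obtain ⟨x, hx⟩ := hM.exists_ultralimit V p hp
  obtain ⟨y, hy⟩ := hM.exists_ultralimit U q hq
  -- With the limits represented by `x` and `y`, both iterated limits mean that `x + y` belongs to
  -- `M`.
  have h1 : y + x ∈ M := (hx y).2 <| h.mono fun a ha => by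
    rw [add_comm]
    exact (hy _).2 ha
  rw [add_comm, hy] at h1
  filter_upwards [h1] with b hb
  rw [add_comm, hx] at hb
  simpa only [add_comm] using hb

theorem IsFinitary.isFiniteType {M : Label} (hM : IsFinitary M) : IsFiniteType M := by
  rintro ⟨m, hm, hmM⟩
  obtain ⟨⟨μ, hμ⟩, hfin⟩ := hM
  by_cases hS : (⋃ i, ((m i).support : Set ℕ+)).Finite
  · refine (Set.infinite_range_of_injective hm.injective)
      ((finite_setOf_support_subset hS.toFinset μ).subset ?_)
    rintro _ ⟨i, rfl⟩
    refine ⟨fun l hl => ?_, hμ _ (hmM i)⟩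
    rw [Set.Finite.mem_toFinset]
    exact mem_iUnion.2 ⟨i, hl⟩
  · let l := Set.Infinite.natEmbedding _ hS
    have hl : ∀ i, ∃ n, (m n) (l i) ≠ 0 := fun i => by
      obtain ⟨n, hn⟩ := mem_iUnion.1 (l i).2
      exact ⟨n, Finsupp.mem_support_iff.1 hn⟩
    have hinj : Function.Injective fun i => (l i : ℕ+) := Subtype.val_injective.comp l.injective
    have h1 := hfin (fun i => {(l i : ℕ+)}) (by
      simp only [Finset.coe_singleton, iUnion_singleton_eq_range]
      exact infinite_range_of_injective hinj)
    refine (infinite_range_of_injective (Finset.singleton_injective.comp hinj)) (h1.subset ?_)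
    rintro _ ⟨k, rfl⟩
    refine Eventually.of_forall fun i => ?_
    obtain ⟨n, hn⟩ := hl k
    obtain ⟨n', hn'⟩ := hl i
    have hle : (Finsupp.indicator ({(l k : ℕ+)} ∪ {(l i : ℕ+)}) fun _ _ => 1 : NVec) ≤
        m (max n n') := by
      intro x
      by_cases hx : x ∈ ({(l k : ℕ+)} ∪ {(l i : ℕ+)} : Finset ℕ+)
      · rw [Finsupp.indicator_of_mem hx]
        have h2 := hm.monotone (le_max_left n n') (l k)
        have h3 := hm.monotone (le_max_right n n') (l i)
        simp only [Finset.mem_union, Finset.mem_singleton] at hx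
        rcases hx with rfl | rfl <;> omega
      · rw [Finsupp.indicator_of_notMem hx]
        exact Nat.zero_le _
    refine ⟨_, M.lower hle (hmM _), ?_⟩
    ext x
    simp only [Finsupp.mem_support_iff, Finsupp.indicator_apply]
    split_ifs with hx
    · exact iff_of_true one_ne_zero hx
    · exact iff_of_false (not_not.2 rfl) hx

/-! ### Weak almost periodicity -/

namespace ExpansionSystem

variable (E : ExpansionSystem)

/-- In a label of finite type, expansions decompose along an ultrafilter into a constant part and
a part whose indices tend to infinity. -/
theorem exists_ultralimit_of_isFiniteType {M : Label} (hM : IsFiniteType M) {ι : Type*}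
    (U : Ultrafilter ι) (f : ι → Finset ℤ)
    (hf : ∀ᶠ i in (U : Filter ι), E.lengthVector (f i) ∈ M) :
    ∃ a : Finset ℤ, (∀ᶠ i in (U : Filter ι), a ⊆ f i) ∧
      ∀ N : ℤ, ∀ᶠ i in (U : Filter ι), ∀ j ∈ f i \ a, N ≤ |j| := by
  have hsub : ∀ a : Finset ℤ, (∀ j ∈ a, ∀ᶠ i in (U : Filter ι), j ∈ f i) →
      ∀ᶠ i in (U : Filter ι), a ⊆ f i := fun a ha => (Finset.eventually_all a).2 ha
  -- Infinitely many persistent indices would yield a strictly increasing chain of length vectors in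
  -- `M`.
  have hS : {j | ∀ᶠ i in (U : Filter ι), j ∈ f i}.Finite := by
    by_contra hS
    let g := Set.Infinite.natEmbedding _ hS
    have hinj : Function.Injective fun i => (g i : ℤ) := Subtype.val_injective.comp g.injective
    let F : ℕ → Finset ℤ := fun n => (Finset.range n).map ⟨_, hinj⟩
    have hF : StrictMono F := (Finset.mapEmbedding _).strictMono.comp
      (Finset.range_mono.strictMono_of_injective fun a b h => by
        simpa using congrArg Finset.card h)
    refine hM ⟨_, E.lengthVector_strictMono.comp hF, fun n => ?_⟩
    have hFn : ∀ j ∈ F n, ∀ᶠ i in (U : Filter ι), j ∈ f i := fun j hj => by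
      obtain ⟨x, -, rfl⟩ := Finset.mem_map.1 hj
      exact (g x).2
    obtain ⟨i, hi, hi'⟩ := ((hsub (F n) hFn).and hf).exists
    exact M.lower (E.lengthVector_mono hi) hi'
  refine ⟨hS.toFinset, hsub _ fun j hj => hS.mem_toFinset.1 hj, fun N => ?_⟩
  have h1 : ∀ᶠ i in (U : Filter ι), ∀ j ∈ Finset.Icc (-N) N \ hS.toFinset, j ∉ f i := by
    rw [Finset.eventually_all]
    intro j hj
    rw [Ultrafilter.eventually_not]
    exact fun h => (Finset.mem_sdiff.1 hj).2 (hS.mem_toFinset.2 h)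
  filter_upwards [h1] with i hi j hj
  by_contra! hlt
  rw [Finset.mem_sdiff] at hj
  exact hi j (Finset.mem_sdiff.2 ⟨Finset.mem_Icc.2 (abs_le.1 hlt.le), hj.2⟩) hj.1

theorem exists_abs_lt (J : Finset ℤ) : ∃ N : ℤ, ∀ j ∈ J, |j| < N :=
  ⟨(J.sup Int.natAbs : ℕ) + 1, fun j hj => by
    rw [Int.abs_eq_natAbs]
    exact_mod_cast Nat.lt_succ_of_le (Finset.le_sup (f := Int.natAbs) hj)⟩

/-- Once a reference `s₀` is fixed, `h t` is the escaping part of the expansion of `s₀ + t`. For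
`V`-most `s`, the expansion of `s + t` is `g s ∪ h t` for `U`-most `t`. The union remains an
expansion in the other order of limits because `g s` in turn splits into a constant and an escaping
part. -/
theorem isStable_restrictedA (Q : ℤ → Prop) {M : Label} (hft : IsFiniteType M)
    (hM : IsSimple M) : IsStable (E.restrictedA Q M) := by
  intro U V hUV
  have hexp : ∀ t : ℤ, ∃ J : Finset ℤ, t ∈ E.restrictedA Q M →
      IsDigitSet J ∧ (∀ j ∈ J, Q j) ∧ E.lengthVector J ∈ M ∧ t = E.value J := fun t => by
    by_cases ht : t ∈ E.restrictedA Q M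
    · obtain ⟨J, hJ⟩ := ht
      exact ⟨J, fun _ => hJ⟩
    · exact ⟨∅, fun h => absurd h ht⟩
  choose e he using hexp
  obtain ⟨s₀, hs₀⟩ := hUV.exists
  obtain ⟨a, ha, hfar⟩ := E.exists_ultralimit_of_isFiniteType hft U (fun t => e (s₀ + t))
    (hs₀.mono fun t ht => (he _ ht).2.2.1)
  let h : ℤ → Finset ℤ := fun t => e (s₀ + t) \ a
  have hval : ∀ᶠ t in (U : Filter ℤ), s₀ + t = E.value a + E.value (h t) := by
    filter_upwards [hs₀, ha] with t ht hat
    rw [← E.value_union Finset.disjoint_sdiff, Finset.union_sdiff_of_subset hat]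
    exact (he _ ht).2.2.2
  obtain ⟨Na, hNa⟩ := exists_abs_lt a
  have hg : ∀ s : ℤ, ∃ c : Finset ℤ, (∀ᶠ t in (U : Filter ℤ), s + t ∈ E.restrictedA Q M) →
      IsDigitSet c ∧ (∀ j ∈ c, Q j) ∧ E.value c = E.value a + s - s₀ ∧
      ∀ᶠ t in (U : Filter ℤ), E.lengthVector c + E.lengthVector (h t) ∈ M := by
    intro s
    by_cases hs : ∀ᶠ t in (U : Filter ℤ), s + t ∈ E.restrictedA Q M
    swap
    · exact ⟨∅, fun h => absurd h hs⟩
    -- Above `N` the constant part `a` is absent, and the expansions of `s + t` and `s₀ + t`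
    -- coincide because their values differ by less than `N`.
    obtain ⟨N, hNa', hNs⟩ : ∃ N, Na ≤ N ∧ |s - s₀| < N :=
      ⟨max Na (|s - s₀| + 1), le_max_left _ _, (lt_add_one _).trans_le (le_max_right _ _)⟩
    let low : ℤ → Finset ℤ := fun t => (e (s + t)).filter fun j => |j| < N
    have hsplit : ∀ᶠ t in (U : Filter ℤ), s + t ∈ E.restrictedA Q M ∧
        e (s + t) = low t ∪ h t ∧ Disjoint (low t) (h t) ∧
        E.value (low t) = E.value a + s - s₀ := by
      filter_upwards [hs₀, ha, hfar N, hs, hval] with t ht hat htN hts htv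
      have hd : Disjoint (low t) (h t) := Finset.disjoint_left.2 fun j hj hj' =>
        absurd (Finset.mem_filter.1 hj).2 (not_lt.2 (htN j hj'))
      have heq : e (s + t) = low t ∪ h t := by
        have hv : E.value (e (s + t)) - E.value (e (s₀ + t)) = s - s₀ := by
          rw [← (he _ ht).2.2.2, ← (he _ hts).2.2.2]
          ring
        ext j
        by_cases hj : |j| < N
        · have : j ∉ h t := fun hjt => absurd hj (not_lt.2 (htN j hjt))
          simp [low, hj, this]
        · have hja : j ∉ a := fun hja => hj ((hNa j hja).trans_le hNa')
          have hjh : j ∈ h t ↔ j ∈ e (s₀ + t) := by simp [h, hja]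
          have hjl : j ∉ low t := by simp [low, hj]
          rw [Finset.mem_union, hjh, or_iff_right hjl]
          push Not at hj
          constructor
          · exact fun hj' => E.mem_of_abs_value_sub_lt (he _ hts).1 (he _ ht).1
              (by rwa [hv]) hj' hj
          · exact fun hj' => E.mem_of_abs_value_sub_lt (he _ ht).1 (he _ hts).1
              (by rwa [abs_sub_comm, hv]) hj' hj
      refine ⟨hts, heq, hd, ?_⟩
      have h1 := E.value_union hd
      rw [← heq, ← (he _ hts).2.2.2] at h1
      linarith
    -- The low part has a value independent of `t`, so by uniqueness it is one fixed set, read off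
    -- at `t₁`.
    obtain ⟨t₁, ht₁, -, -, hv₁⟩ := hsplit.exists
    have hd₁ : IsDigitSet (low t₁) := (he _ ht₁).1.mono (Finset.filter_subset _ _)
    refine ⟨low t₁, fun _ => ⟨hd₁, fun j hj => (he _ ht₁).2.1 j (Finset.mem_of_mem_filter j hj),
      hv₁, ?_⟩⟩
    filter_upwards [hsplit] with t ⟨ht, heq, hd, hv⟩
    have : low t₁ = low t := E.eq_of_value_eq hd₁
      ((he _ ht).1.mono (Finset.filter_subset _ _)) (hv₁.trans hv.symm)
    rw [this, ← E.lengthVector_union hd, ← heq]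
    exact (he _ ht).2.2.1
  choose g hg using hg
  have hgV := hUV.mono fun s hs => hg s hs
  obtain ⟨a', ha', hfar'⟩ := E.exists_ultralimit_of_isFiniteType hft V g
    (hgV.mono fun s hs => hs.2.2.2.exists.elim fun t ht =>
      M.lower (le_add_of_nonneg_right zero_le) ht)
  obtain ⟨Na', hNa'⟩ := exists_abs_lt a'
  have hcomm := hM.eventually_comm V U (fun s => E.lengthVector (g s))
    (fun t => E.lengthVector (h t)) (hgV.mono fun s hs => hs.2.2.2)
  filter_upwards [hcomm, hs₀, ha, hfar Na', hval] with t htM ht hat htN htv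
  obtain ⟨Nt, hNt⟩ := exists_abs_lt (h t)
  -- With `t` fixed, `h t` lies above `a'`, and for `V`-most `s` the rest of `g s` lies above `h t`.
  filter_upwards [htM, hgV, ha', hfar' Nt] with s hsM hs has hsN
  have hh : IsDigitSet (h t) := (he _ ht).1.mono Finset.sdiff_subset
  have hlt₁ : ∀ i ∈ a', ∀ j ∈ h t, |i| < |j| := fun i hi j hj =>
    (hNa' i hi).trans_le (htN j hj)
  have hlt₂ : ∀ i ∈ h t, ∀ j ∈ g s \ a', |i| < |j| := fun i hi j hj =>
    (hNt i hi).trans_le (hsN j hj)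
  have hgs : a' ∪ (g s \ a') = g s := Finset.union_sdiff_of_subset has
  have hd : Disjoint (g s) (h t) := by
    rw [← hgs, Finset.disjoint_union_left]
    exact ⟨disjoint_of_abs_lt hlt₁, (disjoint_of_abs_lt hlt₂).symm⟩
  refine ⟨g s ∪ h t, ⟨fun j hj => (Finset.mem_union.1 hj).elim (hs.1.1 j) (hh.1 j), ?_⟩,
    fun j hj => (Finset.mem_union.1 hj).elim (hs.2.1 j)
      fun hj => (he _ ht).2.1 j (Finset.sdiff_subset hj), ?_, ?_⟩
  · have hne : ∀ i ∈ g s, ∀ j ∈ h t, |i| ≠ |j| := by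
      intro i hi j hj
      rw [← hgs, Finset.mem_union] at hi
      rcases hi with hi | hi
      · exact (hlt₁ i hi j hj).ne
      · exact (hlt₂ j hj i hi).ne'
    intro i hi j hj hij
    rw [Finset.mem_coe, Finset.mem_union] at hi hj
    rcases hi with hi | hi <;> rcases hj with hj | hj
    · exact hs.1.2 hi hj hij
    · exact absurd hij (hne i hi j hj)
    · exact absurd hij.symm (hne j hj i hi)
    · exact hh.2 hi hj hij
  · rw [E.lengthVector_union hd]
    exact hsM
  · rw [E.value_union hd, hs.2.2.1]
    linarith

/-! ### Independence -/

open Classical in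
/-- The orbit closure of the characteristic function of a set of integers. -/
noncomputable def _root_.LabeledSubshift.subshiftOf (A : Set ℤ) : Subshift Bool ℤ :=
  orbitClosure fun t => decide (t ∈ A)

/-- On a finite set, a member of `Θ(M)` agrees with some `M - r`. If `J` has length vector `r` and
indices above those of all `T m` involved, then `J ∪ T m` is the expansion of the sum of the values
and has length vector `m + r`. The shift by the value of `J` thus displays `M - r` on these
coordinates. -/
theorem isIndependentCoord_restrictedA {Q : ℤ → Prop} (hQ : ∀ j, 0 < j → Q j) {M : Label}
    {T : NVec → Finset ℤ} (hT : ∀ m, ∀ j ∈ T m, 0 < j) (hTm : ∀ m, E.lengthVector (T m) = m)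
    {L : Set NVec} (hL : ∀ F : Finset NVec, (F : Set NVec) ⊆ L → IsIndependentLabel M F) :
    IsIndependentCoord (subshiftOf (E.restrictedA Q M)) ((fun m => E.value (T m)) '' L) := by
  classical
  refine isIndependentCoord_of_finite fun K S hK => ?_
  obtain ⟨F, hFL, rfl⟩ := Finset.subset_set_image_iff.1 hK
  obtain ⟨N, hN, hFN⟩ := (hL F hFL).2 {m | m ∈ F ∧ E.value (T m) ∈ S} fun m hm => hm.1
  obtain ⟨r, hr⟩ := exists_translate_of_mem_orbitClosureLabel hN F
  obtain ⟨B, hB⟩ := exists_abs_lt (F.biUnion T)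
  obtain ⟨J, hJ, hJr⟩ := E.exists_lengthVector_eq r B
  refine ⟨E.value J +ᵥ orbitClosureBase _, fun t ht => ?_⟩
  obtain ⟨m, hm, rfl⟩ := Finset.mem_image.1 ht
  have hd : Disjoint J (T m) := Finset.disjoint_left.2 fun j hj hj' => by
    have h1 := hB j (Finset.mem_biUnion.2 ⟨m, hm, hj'⟩)
    rw [abs_of_pos (hJ j hj).1] at h1
    exact absurd h1 (not_lt.2 (hJ j hj).2.le)
  have hpos : ∀ j ∈ J ∪ T m, 0 < j := fun j hj =>
    (Finset.mem_union.1 hj).elim (fun h => (hJ j h).1) (hT m j)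
  have h1 : E.value J + E.value (T m) ∈ E.restrictedA Q M ↔ m + r ∈ M := by
    rw [← E.value_union hd, show m + r = E.lengthVector (J ∪ T m) by
      rw [E.lengthVector_union hd, hJr, hTm, add_comm]]
    constructor
    · rintro ⟨J', hJ', -, hM, hv⟩
      rwa [E.eq_of_value_eq (isDigitSet_of_pos hpos) hJ' hv]
    · exact fun hM => ⟨_, isDigitSet_of_pos hpos, fun j hj => hQ j (hpos j hj), hM, rfl⟩
  have h2 : m ∈ N ↔ E.value (T m) ∈ S := by
    have := Set.ext_iff.1 hFN m
    simpa [hm] using this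
  rw [coe_vadd_apply]
  change decide (E.value J + E.value (T m) ∈ E.restrictedA Q M) = true ↔ _
  rw [decide_eq_true_eq, h1, hr m hm, h2]

theorem value_comp_injective {T : NVec → Finset ℤ} (hT : ∀ m, ∀ j ∈ T m, 0 < j)
    (hTm : ∀ m, E.lengthVector (T m) = m) : Function.Injective fun m => E.value (T m) := by
  intro m m' h
  rw [← hTm m, ← hTm m', E.eq_of_value_eq (isDigitSet_of_pos (hT m)) (isDigitSet_of_pos (hT m')) h]

theorem _root_.LabeledSubshift.IsIndependentLabel.mono {M : Label} {L L' : Set NVec}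
    (h : IsIndependentLabel M L') (hL : L ⊆ L') : IsIndependentLabel M L := by
  refine ⟨hL.trans h.1, fun L₁ hL₁ => ?_⟩
  obtain ⟨N, hN, hLN⟩ := h.2 L₁ (hL₁.trans hL)
  refine ⟨N, hN, ?_⟩
  rw [← inter_eq_self_of_subset_left hL, inter_assoc, hLN, inter_eq_self_of_subset_right hL₁]

theorem not_isNull_restrictedA {Q : ℤ → Prop} (hQ : ∀ j, 0 < j → Q j) {M : Label}
    (hM : IsNonNull M) : ¬ IsNull (subshiftOf (E.restrictedA Q M)) := by
  rintro ⟨n, hn⟩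
  choose T hT hTm using fun m => E.exists_lengthVector_eq m 0
  obtain ⟨F, hF, hcard⟩ := hM (n + 1)
  have h1 := hn _ (E.isIndependentCoord_restrictedA hQ (fun m j hj => (hT m j hj).1) hTm
    fun F' hF' => hF.mono hF')
  rw [(E.value_comp_injective (fun m j hj => (hT m j hj).1) hTm).encard_image,
    Set.encard_coe_eq_coe_finsetCard] at h1
  have : F.card ≤ n := by exact_mod_cast h1
  omega

theorem not_isTame_restrictedA {Q : ℤ → Prop} (hQ : ∀ j, 0 < j → Q j) {M : Label}
    (hM : IsNonTame M) : ¬ IsTame (subshiftOf (E.restrictedA Q M)) := by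
  intro h
  choose T hT hTm using fun m => E.exists_lengthVector_eq m 0
  obtain ⟨L, hL, -, hind⟩ := hM
  exact (hL.image (E.value_comp_injective (fun m j hj => (hT m j hj).1) hTm).injOn)
    (h _ (E.isIndependentCoord_restrictedA hQ (fun m j hj => (hT m j hj).1) hTm hind))

theorem isWAP_restrictedA (Q : ℤ → Prop) {M : Label} (hM : IsSimple M) (hM' : IsFinitary M) :
    IsWAP ℤ (subshiftOf (E.restrictedA Q M)).carrier := by
  refine isWAP_orbitClosure_of_isStable _ ?_
  simpa only [decide_eq_true_eq, ofPred_mem_eq] using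
    E.isStable_restrictedA Q hM'.isFiniteType hM

theorem X_eq (M : Label) : E.X M = subshiftOf (E.restrictedA (fun _ => True) M) := by
  rw [← A_eq]
  rfl

theorem Xplus_eq (M : Label) : E.Xplus M = subshiftOf (E.restrictedA (fun j => 0 < j) M) := by
  rw [← Aplus_eq]
  rfl

end ExpansionSystem

end LabeledSubshift

namespace LabeledSubshift

/-! ### Labels of bipartite graphs -/

section BipartiteLabel

/-- The coordinate of the left vertex `i`. -/
def leftVertex (i : ℕ) : ℕ+ := ⟨2 * i + 1, by omega⟩

/-- The coordinate of the right vertex `j`. -/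
def rightVertex (j : ℕ) : ℕ+ := ⟨2 * j + 2, by omega⟩

theorem leftVertex_inj {i i' : ℕ} : leftVertex i = leftVertex i' ↔ i = i' := by
  rw [← PNat.coe_inj]
  change 2 * i + 1 = 2 * i' + 1 ↔ _
  omega

theorem rightVertex_inj {j j' : ℕ} : rightVertex j = rightVertex j' ↔ j = j' := by
  rw [← PNat.coe_inj]
  change 2 * j + 2 = 2 * j' + 2 ↔ _
  omega

theorem leftVertex_ne_rightVertex (i j : ℕ) : leftVertex i ≠ rightVertex j := by
  rw [Ne, ← PNat.coe_inj]
  change ¬ 2 * i + 1 = 2 * j + 2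
  omega

/-- The vector of the edge between `i` and `j`. -/
noncomputable def edge (i j : ℕ) : NVec :=
  Finsupp.single (leftVertex i) 1 + Finsupp.single (rightVertex j) 1

theorem edge_leftVertex (i j x : ℕ) : edge i j (leftVertex x) = if i = x then 1 else 0 := by
  simp [edge, Finsupp.single_apply, leftVertex_inj, (leftVertex_ne_rightVertex _ _).symm]

theorem edge_rightVertex (i j x : ℕ) : edge i j (rightVertex x) = if j = x then 1 else 0 := by
  simp [edge, Finsupp.single_apply, rightVertex_inj, leftVertex_ne_rightVertex]

theorem edge_le_one (i j : ℕ) (l : ℕ+) : edge i j l ≤ 1 := by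
  rw [edge, Finsupp.add_apply, Finsupp.single_apply, Finsupp.single_apply]
  split_ifs with h h' <;> simp
  exact leftVertex_ne_rightVertex i j (h.trans h'.symm)

theorem degree_edge (i j : ℕ) : (edge i j).degree = 2 := by
  simp [edge]

variable (R : ℕ → ℕ → Prop)

/-- The label generated by the edges of a bipartite graph. -/
noncomputable def bipartiteLabel : Label :=
  lowerClosure {m | ∃ i j, R i j ∧ edge i j = m}

variable {R}

theorem mem_bipartiteLabel {m : NVec} :
    m ∈ bipartiteLabel R ↔ ∃ i j, R i j ∧ m ≤ edge i j := by
  simp only [bipartiteLabel, mem_lowerClosure, mem_ofPred_eq]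
  exact ⟨fun ⟨_, ⟨i, j, h, rfl⟩, hm⟩ => ⟨i, j, h, hm⟩, fun ⟨i, j, h, hm⟩ =>
    ⟨_, ⟨i, j, h, rfl⟩, hm⟩⟩

theorem edge_mem_bipartiteLabel {i j : ℕ} : edge i j ∈ bipartiteLabel R ↔ R i j := by
  rw [mem_bipartiteLabel]
  refine ⟨fun ⟨i', j', h, hle⟩ => ?_, fun h => ⟨i, j, h, le_rfl⟩⟩
  have h1 := hle (leftVertex i)
  have h2 := hle (rightVertex j)
  rw [edge_leftVertex, edge_leftVertex, if_pos rfl] at h1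
  rw [edge_rightVertex, edge_rightVertex, if_pos rfl] at h2
  split_ifs at h1 h2 with h3 h4
  · rwa [← h3, ← h4]
  all_goals omega

theorem degree_le_two {m : NVec} (hm : m ∈ bipartiteLabel R) : m.degree ≤ 2 := by
  obtain ⟨i, j, -, hle⟩ := mem_bipartiteLabel.1 hm
  exact (Finsupp.degree_mono hle).trans (degree_edge i j).le

theorem isFiniteType_bipartiteLabel : IsFiniteType (bipartiteLabel R) := by
  rintro ⟨m, hm, hmM⟩
  have h1 : StrictMono fun n => (m n).degree := fun a b hab => by
    obtain ⟨c, hc⟩ := le_iff_exists_add.1 (hm hab).le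
    have hne : c ≠ 0 := fun h0 => (hm hab).ne (by rw [hc, h0, add_zero])
    have : c.degree ≠ 0 := fun h0 => hne ((Finsupp.degree_eq_zero_iff c).1 h0)
    simp only [hc, map_add]
    omega
  -- A strictly increasing degree is at least `3` at the index `3`, above the bound `2`.
  have h2 := h1.id_le 3
  have h3 := degree_le_two (hmM 3)
  simp only [id] at h2
  omega

/-- The translate by the right vertex `j` contains the left vertex `i` exactly when `R i j`, so
neighbourhoods of right vertices act as traces. -/
theorem isIndependentLabel_bipartiteLabel (I : Finset ℕ)
    (hI : ∀ S ⊆ I, ∃ j, ∀ i ∈ I, R i j ↔ i ∈ S) :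
    IsIndependentLabel (bipartiteLabel R)
      ((fun i => Finsupp.single (leftVertex i) 1) '' (I : Set ℕ)) := by
  classical
  have key : ∀ i j, Finsupp.single (leftVertex i) 1 + Finsupp.single (rightVertex j) 1 ∈
      bipartiteLabel R ↔ R i j := fun i j => edge_mem_bipartiteLabel
  constructor
  · rintro _ ⟨i, hi, rfl⟩
    obtain ⟨j, hj⟩ := hI I subset_rfl
    exact (bipartiteLabel R).lower (le_add_of_nonneg_right zero_le)
      ((key i j).2 ((hj i hi).2 hi))
  · intro L₁ hL₁
    obtain ⟨j, hj⟩ := hI (I.filter fun i => Finsupp.single (leftVertex i) 1 ∈ L₁)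
      (Finset.filter_subset _ _)
    refine ⟨_, subset_closure ⟨Finsupp.single (rightVertex j) 1, rfl⟩, ?_⟩
    ext m
    constructor
    · rintro ⟨⟨i, hi, rfl⟩, hm⟩
      exact (Finset.mem_filter.1 ((hj i hi).1 ((key i j).1 hm))).2
    · intro hm
      obtain ⟨i, hi, rfl⟩ := hL₁ hm
      exact ⟨⟨i, hi, rfl⟩, (key i j).2 ((hj i hi).2 (Finset.mem_filter.2 ⟨hi, hm⟩))⟩

theorem single_leftVertex_injective :
    Function.Injective fun i => (Finsupp.single (leftVertex i) 1 : NVec) := fun _ _ h =>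
  leftVertex_inj.1 (Finsupp.single_left_injective one_ne_zero h)

theorem isNonNull_bipartiteLabel
    (hR : ∀ n : ℕ, ∃ I : Finset ℕ, n ≤ I.card ∧ ∀ S ⊆ I, ∃ j, ∀ i ∈ I, R i j ↔ i ∈ S) :
    IsNonNull (bipartiteLabel R) := by
  classical
  intro n
  obtain ⟨I, hn, hI⟩ := hR n
  refine ⟨I.image fun i => Finsupp.single (leftVertex i) 1, ?_, ?_⟩
  · rw [Finset.coe_image]
    exact isIndependentLabel_bipartiteLabel I hI
  · rwa [Finset.card_image_of_injective _ single_leftVertex_injective]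

theorem isNonTame_bipartiteLabel
    (hR : ∀ I S : Finset ℕ, S ⊆ I → ∃ j, ∀ i ∈ I, R i j ↔ i ∈ S) :
    IsNonTame (bipartiteLabel R) := by
  have key : ∀ F : Finset NVec,
      (F : Set NVec) ⊆ range (fun i => Finsupp.single (leftVertex i) 1) →
      IsIndependentLabel (bipartiteLabel R) F := by
    classical
    intro F hF
    obtain ⟨I, -, rfl⟩ := Finset.subset_set_image_iff.1 (image_univ ▸ hF)
    rw [Finset.coe_image]
    exact isIndependentLabel_bipartiteLabel I (hR I)
  refine ⟨_, infinite_range_of_injective single_leftVertex_injective, ?_, key⟩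
  rintro _ ⟨i, rfl⟩
  exact (key {Finsupp.single (leftVertex i) 1} (by simp)).1 (by simp)

/-- In a locally finite graph, a vertex lies in the support of finitely many vectors of the
label. -/
theorem finite_mem_bipartiteLabel (h₁ : ∀ i, {j | R i j}.Finite) (h₂ : ∀ j, {i | R i j}.Finite)
    (v : ℕ+) : {m ∈ (bipartiteLabel R : Set NVec) | m v ≠ 0}.Finite := by
  have hE : {e : ℕ × ℕ | R e.1 e.2 ∧ (leftVertex e.1 = v ∨ rightVertex e.2 = v)}.Finite := by
    by_cases hv : ∃ i, leftVertex i = v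
    · obtain ⟨i, rfl⟩ := hv
      refine ((h₁ i).image fun j => (i, j)).subset ?_
      rintro ⟨i', j⟩ ⟨h, h' | h'⟩
      · obtain rfl := leftVertex_inj.1 h'
        exact ⟨j, h, rfl⟩
      · exact absurd h'.symm (leftVertex_ne_rightVertex _ _)
    by_cases hv' : ∃ j, rightVertex j = v
    · obtain ⟨j, rfl⟩ := hv'
      refine ((h₂ j).image fun i => (i, j)).subset ?_
      rintro ⟨i, j'⟩ ⟨h, h' | h'⟩
      · exact absurd h' (leftVertex_ne_rightVertex _ _)
      · obtain rfl := rightVertex_inj.1 h'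
        exact ⟨i, h, rfl⟩
    · refine finite_empty.subset ?_
      rintro ⟨i, j⟩ ⟨-, h | h⟩
      · exact hv ⟨i, h⟩
      · exact hv' ⟨j, h⟩
  refine (hE.biUnion fun e _ => Set.finite_Icc (0 : NVec) (edge e.1 e.2)).subset ?_
  rintro m ⟨hm, hmv⟩
  obtain ⟨i, j, h, hle⟩ := mem_bipartiteLabel.1 hm
  refine mem_iUnion₂.2 ⟨(i, j), ⟨h, ?_⟩, zero_le, hle⟩
  by_contra! hne
  have h1 := hle v
  rw [edge, Finsupp.add_apply, Finsupp.single_eq_of_ne hne.1.symm,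
    Finsupp.single_eq_of_ne hne.2.symm] at h1
  omega

theorem isBounded_bipartiteLabel : IsBounded (bipartiteLabel R) := by
  refine ⟨fun _ => 1, fun m hm l => ?_⟩
  obtain ⟨i, j, -, hle⟩ := mem_bipartiteLabel.1 hm
  exact (hle l).trans (edge_le_one i j l)

/-- A point `v` of `G` forces all late `F i` into the supports of the finitely many members that are
nonzero at `v`, so their union is finite. Only `G = ∅` can survive. -/
theorem isFinitary_bipartiteLabel (h₁ : ∀ i, {j | R i j}.Finite) (h₂ : ∀ j, {i | R i j}.Finite) :
    IsFinitary (bipartiteLabel R) := by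
  refine ⟨isBounded_bipartiteLabel, fun F hF => (finite_singleton ∅).subset fun G hG => ?_⟩
  by_contra hne
  obtain ⟨v, hv⟩ := Finset.nonempty_iff_ne_empty.2 hne
  obtain ⟨n, hn⟩ := eventually_atTop.1 hG
  refine hF (((((Finset.range n).finite_toSet.biUnion fun i _ => (F i).finite_toSet)).union
    ((finite_mem_bipartiteLabel h₁ h₂ v).biUnion fun m _ => m.support.finite_toSet)).subset ?_)
  refine iUnion_subset fun i x hx => ?_
  by_cases hi : i < n
  · exact Or.inl (mem_iUnion₂.2 ⟨i, Finset.mem_coe.2 (Finset.mem_range.2 hi), hx⟩)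
  · obtain ⟨m, hm, hms⟩ := hn i (not_lt.1 hi)
    refine Or.inr (mem_iUnion₂.2 ⟨m, ⟨hm, ?_⟩, ?_⟩)
    · rw [← Finsupp.mem_support_iff, hms]
      exact Finset.mem_union_left _ hv
    · rw [hms]
      exact Finset.mem_coe.2 (Finset.mem_union_right _ hx)

/-- Either some vector `s` recurs in the sequence, and the limit is the translate by `s`, or the
sequence leaves every finite set. In the second case local finiteness reduces the limit to `{0}`,
which is the translate by any edge, edges being maximal. -/
theorem isSimple_bipartiteLabel (h₁ : ∀ i, {j | R i j}.Finite) (h₂ : ∀ j, {i | R i j}.Finite)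
    (hne : ∃ i j, R i j) : IsSimple (bipartiteLabel R) := by
  refine ⟨isBounded_bipartiteLabel, fun r hr N hN => ?_⟩
  have hev : ∀ w, ∀ᶠ n in atTop, (w + r n ∈ bipartiteLabel R ↔ w ∈ N) := by
    intro w
    obtain ⟨K, hK⟩ := exists_mem_box w
    filter_upwards [hN.eventually (Metric.ball_mem_nhds N
      (by positivity : (0 : ℝ) < (1 / 2) ^ K))] with n hn
    have h1 := Set.ext_iff.1 (inter_box_eq_of_dist_lt hn) w
    simp only [mem_inter_iff, hK, and_true] at h1
    exact h1
  by_cases hs : ∃ s, ∃ᶠ n in atTop, r n = s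
  · obtain ⟨s, hs⟩ := hs
    refine ⟨s, ?_⟩
    ext w
    obtain ⟨n, rfl, hn⟩ := (hs.and_eventually (hev w)).exists
    exact hn.symm
  · push Not at hs
    obtain ⟨i, j, hij⟩ := hne
    refine ⟨edge i j, ?_⟩
    ext w
    change w ∈ N ↔ w + edge i j ∈ bipartiteLabel R
    by_cases hw : w = 0
    · subst hw
      rw [zero_add, edge_mem_bipartiteLabel]
      obtain ⟨n, hn⟩ := (hev 0).exists
      rw [zero_add] at hn
      exact iff_of_true (hn.1 (hr n)) hij
    · refine iff_of_false (fun hwN => ?_) fun hmem => ?_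
      · obtain ⟨v, hv⟩ := Finsupp.ne_iff.1 hw
        rw [Finsupp.zero_apply] at hv
        have hfin : {s | w + s ∈ bipartiteLabel R}.Finite := by
          refine Set.Finite.of_finite_image (f := (w + ·)) ?_ (add_right_injective w).injOn
          refine (finite_mem_bipartiteLabel h₁ h₂ v).subset ?_
          rintro _ ⟨s, hs, rfl⟩
          refine ⟨hs, ?_⟩
          rw [Finsupp.add_apply]
          omega
        have h1 : ∀ᶠ n in atTop, ∀ s ∈ {s | w + s ∈ bipartiteLabel R}, r n ≠ s :=
          hfin.eventually_all.2 fun s _ => by simpa using hs s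
        obtain ⟨n, hn, hn'⟩ := (h1.and (hev w)).exists
        exact hn _ (hn'.2 hwN) rfl
      · have h1 := degree_le_two hmem
        rw [map_add, degree_edge] at h1
        exact hw ((Finsupp.degree_eq_zero_iff w).1 (by omega))

end BipartiteLabel

/-! ### Existence of the labels and of an expansion system -/

theorem exists_testBit_iff_mem (S : Finset ℕ) : ∃ j : ℕ, ∀ i, j.testBit i = true ↔ i ∈ S := by
  refine ⟨∑ i ∈ S, 2 ^ i, fun i => ?_⟩
  rw [← Nat.mem_bitIndices, ← List.mem_toFinset, Finset.toFinset_bitIndices_sum_two_pow]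

theorem exists_isSimple_isFinitary_isNonNull :
    ∃ M : Label, IsSimple M ∧ IsFinitary M ∧ IsNonNull M := by
  classical
  -- Disjoint finite blocks: block `n` has `n` left vertices and `2 ^ n` right vertices, one for
  -- each subset of the left ones, coded in binary. Finite blocks give local finiteness.
  let R : ℕ → ℕ → Prop := fun i j => i.unpair.1 = j.unpair.1 ∧ i.unpair.2 < i.unpair.1 ∧
    j.unpair.2 < 2 ^ j.unpair.1 ∧ j.unpair.2.testBit i.unpair.2 = true
  have h₁ : ∀ i, {j | R i j}.Finite := fun i => by
    refine ((Finset.range (2 ^ i.unpair.1)).image (Nat.pair i.unpair.1)).finite_toSet.subset ?_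
    rintro j ⟨h, -, h', -⟩
    exact Finset.mem_coe.2 (Finset.mem_image.2 ⟨j.unpair.2, Finset.mem_range.2 (h ▸ h'),
      by rw [h, Nat.pair_unpair]⟩)
  have h₂ : ∀ j, {i | R i j}.Finite := fun j => by
    refine ((Finset.range j.unpair.1).image (Nat.pair j.unpair.1)).finite_toSet.subset ?_
    rintro i ⟨h, h', -⟩
    exact Finset.mem_coe.2 (Finset.mem_image.2 ⟨i.unpair.2, Finset.mem_range.2 (h ▸ h'),
      by rw [← h, Nat.pair_unpair]⟩)
  have h₃ : ∀ n : ℕ, ∃ I : Finset ℕ, n ≤ I.card ∧ ∀ S ⊆ I, ∃ j, ∀ i ∈ I, R i j ↔ i ∈ S := by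
    intro n
    have hinj : Function.Injective (Nat.pair n) := fun a b h => (Nat.pair_eq_pair.1 h).2
    refine ⟨(Finset.range n).image (Nat.pair n), ?_, fun S hS => ?_⟩
    · rw [Finset.card_image_of_injective _ hinj, Finset.card_range]
    · obtain ⟨c, hc⟩ := exists_testBit_iff_mem ((Finset.range n).filter fun x => Nat.pair n x ∈ S)
      have hlt : c < 2 ^ n := by
        refine Nat.lt_pow_two_of_testBit c fun x hx => ?_
        rw [← Bool.not_eq_true, hc]
        exact fun h => absurd (Finset.mem_range.1 (Finset.mem_filter.1 h).1) (not_lt.2 hx)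
      refine ⟨Nat.pair n c, fun i hi => ?_⟩
      obtain ⟨x, hx, rfl⟩ := Finset.mem_image.1 hi
      have hx' := Finset.mem_range.1 hx
      simp only [R, Nat.unpair_pair, hc, Finset.mem_filter, Finset.mem_range]
      tauto
  refine ⟨bipartiteLabel R, isSimple_bipartiteLabel h₁ h₂ ?_, isFinitary_bipartiteLabel h₁ h₂,
    isNonNull_bipartiteLabel h₃⟩
  obtain ⟨I, hI, hIS⟩ := h₃ 1
  obtain ⟨i, hi⟩ := Finset.card_pos.1 hI
  obtain ⟨j, hj⟩ := hIS I subset_rfl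
  exact ⟨i, j, (hj i hi).2 hi⟩

/-- Here the binary digits of a single `j` encode an arbitrary finite neighbourhood in all of `ℕ`.
-/
theorem exists_isFiniteType_isNonTame : ∃ M : Label, IsFiniteType M ∧ IsNonTame M :=
  ⟨bipartiteLabel fun i j => j.testBit i = true, isFiniteType_bipartiteLabel,
    isNonTame_bipartiteLabel fun _ S _ =>
      (exists_testBit_iff_mem S).imp fun _ hj i _ => hj i⟩

/-- The expansion system with `k n = sign n * 5 ^ |n|` and the partition of the positive integers
by the exponent of `2`. -/
def powFiveSystem : ExpansionSystem where
  b := 3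
  three_le_b := le_rfl
  k n := n.sign * 5 ^ n.natAbs
  k_neg n := by simp
  k_expanding n := by
    -- A geometric sum starting at `5`, since the sign kills the term with index `0`.
    have key : ∀ n : ℕ, 4 * ∑ i ∈ Finset.range (n + 1), ((i : ℤ).sign * 5 ^ (i : ℤ).natAbs) =
        5 ^ (n + 1) - 5 := fun n => by
      induction n with
      | zero => simp
      | succ n ih =>
        rw [Finset.sum_range_succ, mul_add, ih, Int.sign_eq_one_of_pos (by positivity),
          Int.natAbs_natCast]
        ring
    have h1 := key n
    have h2 : (0 : ℤ) < 5 ^ (n + 1) := by positivity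
    have h3 : ((n : ℤ) + 1).natAbs = n + 1 := by omega
    rw [Int.sign_eq_one_of_pos (by positivity), h3]
    push_cast
    linarith
  k_one := by norm_num
  cell n := Nat.succPNat (padicValNat 2 n)
  cell_infinite l := by
    have h1 : Function.Injective fun x : ℕ =>
        (⟨2 ^ ((l : ℕ) - 1) * (2 * x + 1), by positivity⟩ : ℕ+) := fun x y h => by
      have h2 := congrArg PNat.val h
      have h3 := Nat.eq_of_mul_eq_mul_left (by positivity) h2
      omega
    refine (infinite_range_of_injective h1).mono ?_
    rintro _ ⟨x, rfl⟩
    have h2 : padicValNat 2 (2 ^ ((l : ℕ) - 1) * (2 * x + 1)) = (l : ℕ) - 1 := by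
      rw [padicValNat.mul (by positivity) (by omega), padicValNat.prime_pow,
        padicValNat.eq_zero_of_not_dvd (by omega), add_zero]
    change Nat.succPNat (padicValNat 2 (2 ^ ((l : ℕ) - 1) * (2 * x + 1))) = l
    rw [h2, ← PNat.coe_inj, Nat.succPNat_coe]
    have := l.pos
    omega
  cell_min l := by
    -- The cell of index `l` contains `2 ^ (l - 1)`, and the members of the next cell are multiples
    -- of `2 ^ l`.
    refine ⟨⟨2 ^ ((l : ℕ) - 1), by positivity⟩, ?_, fun n' hn' => ?_⟩
    · change Nat.succPNat (padicValNat 2 (2 ^ ((l : ℕ) - 1))) = l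
      rw [padicValNat.prime_pow, ← PNat.coe_inj, Nat.succPNat_coe]
      have := l.pos
      omega
    · rw [← PNat.coe_inj, Nat.succPNat_coe, PNat.add_coe, PNat.one_coe] at hn'
      have h1 : 2 ^ (l : ℕ) ∣ (n' : ℕ) := by
        have : padicValNat 2 n' = l := by omega
        rw [← this]
        exact pow_padicValNat_dvd
      change 2 ^ ((l : ℕ) - 1) < (n' : ℕ)
      refine lt_of_lt_of_le ?_ (Nat.le_of_dvd n'.pos h1)
      have := l.pos
      exact Nat.pow_lt_pow_right (by omega) (by omega)

end LabeledSubshift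

/-! ### The main theorem -/

theorem mainTheorem5 :
    -- simple finitary non-null labels and their subshifts
    (∃ M : LabeledSubshift.Label, LabeledSubshift.IsSimple M ∧ LabeledSubshift.IsFinitary M ∧
      LabeledSubshift.IsNonNull M) ∧
    (∀ M : LabeledSubshift.Label, LabeledSubshift.IsSimple M → LabeledSubshift.IsFinitary M →
      LabeledSubshift.IsNonNull M → ∀ E : LabeledSubshift.ExpansionSystem,
      (AddAction.IsTopologicallyTransitive ℤ (E.X M).carrier ∧
        LabeledSubshift.IsWAP ℤ (E.X M).carrier ∧ ¬ LabeledSubshift.IsNull (E.X M)) ∧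
      (AddAction.IsTopologicallyTransitive ℤ (E.Xplus M).carrier ∧
        LabeledSubshift.IsWAP ℤ (E.Xplus M).carrier ∧
        ¬ LabeledSubshift.IsNull (E.Xplus M))) ∧
    (∃ Y : Subshift Bool ℤ, AddAction.IsTopologicallyTransitive ℤ Y.carrier ∧
      LabeledSubshift.IsWAP ℤ Y.carrier ∧ ¬ LabeledSubshift.IsNull Y) ∧
    -- non-tame labels of finite type and their subshifts
    (∃ M : LabeledSubshift.Label, LabeledSubshift.IsFiniteType M ∧
      LabeledSubshift.IsNonTame M) ∧
    (∀ M : LabeledSubshift.Label, LabeledSubshift.IsFiniteType M →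
      LabeledSubshift.IsNonTame M → ∀ E : LabeledSubshift.ExpansionSystem,
      (AddAction.IsTopologicallyTransitive ℤ (E.X M).carrier ∧
        ¬ LabeledSubshift.IsTame (E.X M) ∧ ¬ LabeledSubshift.IsWAP ℤ (E.X M).carrier) ∧
      (AddAction.IsTopologicallyTransitive ℤ (E.Xplus M).carrier ∧
        ¬ LabeledSubshift.IsTame (E.Xplus M) ∧
        ¬ LabeledSubshift.IsWAP ℤ (E.Xplus M).carrier)) ∧
    (∃ Y : Subshift Bool ℤ, AddAction.IsTopologicallyTransitive ℤ Y.carrier ∧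
      ¬ LabeledSubshift.IsTame Y ∧ ¬ LabeledSubshift.IsWAP ℤ Y.carrier) := by
  have hX : ∀ A : Set ℤ, AddAction.IsTopologicallyTransitive ℤ
      (LabeledSubshift.subshiftOf A).carrier := fun A =>
    LabeledSubshift.isTopologicallyTransitive_orbitClosure _
  have hwap : ∀ M : LabeledSubshift.Label, LabeledSubshift.IsSimple M →
      LabeledSubshift.IsFinitary M → LabeledSubshift.IsNonNull M →
      ∀ E : LabeledSubshift.ExpansionSystem,
      (AddAction.IsTopologicallyTransitive ℤ (E.X M).carrier ∧
        LabeledSubshift.IsWAP ℤ (E.X M).carrier ∧ ¬ LabeledSubshift.IsNull (E.X M)) ∧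
      (AddAction.IsTopologicallyTransitive ℤ (E.Xplus M).carrier ∧
        LabeledSubshift.IsWAP ℤ (E.Xplus M).carrier ∧
        ¬ LabeledSubshift.IsNull (E.Xplus M)) := by
    intro M hs hf hn E
    rw [E.X_eq, E.Xplus_eq]
    exact ⟨⟨hX _, E.isWAP_restrictedA _ hs hf, E.not_isNull_restrictedA (fun _ _ => trivial) hn⟩,
      hX _, E.isWAP_restrictedA _ hs hf, E.not_isNull_restrictedA (fun _ h => h) hn⟩
  have htame : ∀ M : LabeledSubshift.Label, LabeledSubshift.IsNonTame M →
      ∀ E : LabeledSubshift.ExpansionSystem,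
      (AddAction.IsTopologicallyTransitive ℤ (E.X M).carrier ∧
        ¬ LabeledSubshift.IsTame (E.X M) ∧ ¬ LabeledSubshift.IsWAP ℤ (E.X M).carrier) ∧
      (AddAction.IsTopologicallyTransitive ℤ (E.Xplus M).carrier ∧
        ¬ LabeledSubshift.IsTame (E.Xplus M) ∧
        ¬ LabeledSubshift.IsWAP ℤ (E.Xplus M).carrier) := by
    intro M hn E
    rw [E.X_eq, E.Xplus_eq]
    have h1 := E.not_isTame_restrictedA (Q := fun _ => True) (fun _ _ => trivial) hn
    have h2 := E.not_isTame_restrictedA (Q := fun j => 0 < j) (fun _ h => h) hn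
    exact ⟨⟨hX _, h1, fun h => h1 h.isTame⟩, hX _, h2, fun h => h2 h.isTame⟩
  obtain ⟨M, hs, hf, hn⟩ := LabeledSubshift.exists_isSimple_isFinitary_isNonNull
  obtain ⟨M', hf', hn'⟩ := LabeledSubshift.exists_isFiniteType_isNonTame
  exact ⟨⟨M, hs, hf, hn⟩, hwap,
    ⟨_, (hwap M hs hf hn LabeledSubshift.powFiveSystem).1⟩, ⟨M', hf', hn'⟩,
    fun M _ => htame M, ⟨_, (htame M' hn' LabeledSubshift.powFiveSystem).1⟩⟩
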